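/- Let $\mathcal P_4\subset\mathbb R^3$ be a regular tetrahedron with edges of length $1$ and faces $F_1,F_2,F_3,F_4$ (closed triangles). Definitions. A net of $\mathcal P_4$ is an unfolding of its surface into the plane after cutting along some of its edges: the four faces are laid out isometrically in $\mathbb R^2$, preserving the direction of rotation around each face (seen from outside), without overlap, and connected through uncut edges. Its dual graph has the four faces as vertices, two faces being adjacent when they are glued along their common edge in the net. A landscape $L$ is the union of the faces of a net along a path with at least two vertices in the dual graph; it is determined by its sequence of faces. $L(F_a\to F_b)$ indicates that the path has end faces $F_a$ and $F_b$. A sublandscape of $L$ is a landscape given by a subpath. If $p,q$ are points of $L$ (each taken in a given face of $L$), then $|T_L(p,q)|$ is the length of the planar segment joining their copies in $L$ if this segment lies within $L$, and $\infty$ otherwise. For $p_1\in F_{n_1}$, $p_2\in F_{n_2}$ and $L=L(F_{n_1}\to F_{n_2})$, the copies used are those in $F_{n_1}$ and $F_{n_2}$. The surface distance $d_{\mathcal P_4}(p,q)$ is the infimum of the lengths of the paths from $p$ to $q$ on the surface of $\mathcal P_4$. A landscape $L$ is valid if it has points $p,q$ with $|T_L(p,q)|=d_{\mathcal P_4}(p,q)$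 such that no landscape $M\neq L$ containing $p,q$ with $|T_M(p,q)|=|T_L(p,q)|$ is a sublandscape of $L$. A point $p\in F_n$ has the representation $(F_n,F_m,x,y)$, $m\ne n$, if the isometric map of $F_n$ into the closed upper half-plane which sends the common edge $uv$ of $F_n$ and $F_m$ to the segment from $(0,0)$ (image of $u$) to $(1,0)$ (image of $v$) sends $p$ to $(x,y)$; here $v$ directly follows $u$ counter-clockwise around $F_n$, seen from outside. Theorem. Let $F_{n_1}\neq F_{n_2}$ be faces of $\mathcal P_4$. 1. There are exactly $5$ landscapes $L(F_{n_1}\to F_{n_2})$ of $\mathcal P_4$, and all $5$ are valid. 2. Let $F_{n_3},F_{n_4}$ be the other two faces, named so that $F_{n_2},F_{n_4},F_{n_3}$ is their counter-clockwise order around $F_{n_1}$, seen from outside. The five landscapes are those with face sequences $L_1=(F_{n_1},F_{n_2})$, $L_2=(F_{n_1},F_{n_3},F_{n_2})$, $L_3=(F_{n_1},F_{n_4},F_{n_2})$, $L_4=(F_{n_1},F_{n_3},F_{n_4},F_{n_2})$, $L_5=(F_{n_1},F_{n_4},F_{n_3},F_{n_2})$. For all points $p_1=(F_{n_1},F_{n_2},x_1,y_1)\in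 F_{n_1}\setminus F_{n_2}$ and $p_2=(F_{n_2},F_{n_1},x_2,y_2)\in F_{n_2}\setminus F_{n_1}$, $$d_{\mathcal P_4}(p_1,p_2)=\min_{1\le i\le 5}|T_{L_i}(p_1,p_2)|,$$ where $$|T_{L_1}(p_1,p_2)|=\sqrt{(x_1+x_2-1)^2+(y_1+y_2)^2},$$ $$|T_{L_2}(p_1,p_2)|=\sqrt{(x_1-x_2+1)^2+(y_1-y_2)^2},$$ $$|T_{L_3}(p_1,p_2)|=\sqrt{(x_1-x_2-1)^2+(y_1-y_2)^2},$$ $$|T_{L_4}(p_1,p_2)|=\sqrt{(x_1+x_2)^2+(y_1+y_2-\sqrt3)^2},$$ $$|T_{L_5}(p_1,p_2)|=\sqrt{(x_1+x_2-2)^2+(y_1+y_2-\sqrt3)^2}.$$ -/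

import Mathlib

noncomputable section

/-- A regular tetrahedron in `ℝ³` all of whose edges have length `1`. The faces and the vertices
are labelled by `Fin 4` so that the vertex `V n` is the one opposite to the face `F n`: it is the
vertex that lies on the three other faces. -/
structure UnitTetrahedron where
  /-- the four vertices -/
  V : Fin 4 → EuclideanSpace ℝ (Fin 3)
  dist_eq_one : ∀ i j, i ≠ j → dist (V i) (V j) = 1

namespace UnitTetrahedron

variable (P : UnitTetrahedron)

/-- The closed triangular face `F n`, spanned by the vertices other than `V n`. -/
def face (n : Fin 4) : Set (EuclideanSpace ℝ (Fin 3)) :=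
  convexHull ℝ (P.V '' {j | j ≠ n})

/-- The surface of the tetrahedron. -/
def surface : Set (EuclideanSpace ℝ (Fin 3)) := ⋃ n, P.face n

/-- `V u`, `V v`, `V w` are the three vertices of the face `F n`, listed in counter-clockwise order
as seen from outside the tetrahedron. (The vector `(V v - V u) × (V w - V u)` points away from the
opposite vertex `V n`.) -/
def CCW (n u v w : Fin 4) : Prop :=
  [n, u, v, w].Nodup ∧
    (Matrix.of fun i j : Fin 3 =>
      (![P.V v - P.V u, P.V w - P.V u, P.V n - P.V u] i) j).det < 0

/-- `(F n, F m, x, y)` is a representation of the point `p`: home-face `F n`, shared-face `F m`,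
coordinates `(x, y)`. Here `V u`, `V v` are the ends of the common edge of `F n` and `F m`, with
`V v` directly after `V u` counter-clockwise around `F n` (the third vertex of `F n` is `V m`). The
face is mapped isometrically into the upper half-plane, with `V u ↦ (0,0)` and `V v ↦ (1,0)`, and
`p` goes to `(x, y)`. -/
def HasRep (p : EuclideanSpace ℝ (Fin 3)) (n m : Fin 4) (x y : ℝ) : Prop :=
  p ∈ P.face n ∧ ∃ u v : Fin 4, P.CCW n u v m ∧
    ∃ g : EuclideanSpace ℝ (Fin 3) → EuclideanSpace ℝ (Fin 2),
      (∀ a ∈ P.face n, ∀ b ∈ P.face n, dist (g a) (g b) = dist a b) ∧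
      (∀ a ∈ P.face n, 0 ≤ g a 1) ∧
      g (P.V u) = !₂[0, 0] ∧ g (P.V v) = !₂[1, 0] ∧ g p = !₂[x, y]

/-- The surface distance: the infimum of the lengths of all the paths from `p` to `q` that stay on
the surface of the tetrahedron (the length of a path is its total variation in `ℝ³`). -/
def surfaceDist (p q : EuclideanSpace ℝ (Fin 3)) : ENNReal :=
  ⨅ (γ : Path p q) (_ : ∀ t, γ t ∈ P.surface), eVariationOn γ Set.univ

/-- The dual graph of a planar layout of the faces, in which `pl n` puts the face `F n` into the
plane: two distinct faces are adjacent when their copies in the plane are glued along their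
common edge. -/
def dualGraph (pl : Fin 4 → EuclideanSpace ℝ (Fin 3) → EuclideanSpace ℝ (Fin 2)) :
    SimpleGraph (Fin 4) where
  Adj m n := m ≠ n ∧ ∀ a ∈ P.face m ∩ P.face n, pl m a = pl n a
  symm := ⟨fun _ _ h => ⟨h.1.symm, fun a ha => (h.2 a ha.symm).symm⟩⟩
  loopless := ⟨fun _ h => h.1 rfl⟩

/-- A net of the tetrahedron, that is, an unfolding of its surface into the plane after cutting
along some of its edges. It is recorded by the maps that put the faces into the plane (only the
values of `place n` on `F n` matter). -/
structure Net where
  /-- `place n` sends a point of the face `F n` to its copy in the plane. -/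
  place : Fin 4 → EuclideanSpace ℝ (Fin 3) → EuclideanSpace ℝ (Fin 2)
  /-- the faces are not deformed -/
  isometric : ∀ n, ∀ a ∈ P.face n, ∀ b ∈ P.face n, dist (place n a) (place n b) = dist a b
  /-- the direction of rotation around each face is preserved -/
  preserves_rotation : ∀ n u v w, P.CCW n u v w →
    0 < (place n (P.V v) - place n (P.V u)) 0 * (place n (P.V w) - place n (P.V u)) 1 -
      (place n (P.V v) - place n (P.V u)) 1 * (place n (P.V w) - place n (P.V u)) 0
  /-- distinct faces do not overlap -/
  nonoverlapping : ∀ m n, m ≠ n →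
    Disjoint (interior (place m '' P.face m)) (interior (place n '' P.face n))
  /-- the net is in one piece, connected through its uncut edges -/
  connected : (P.dualGraph place).Connected

variable {P}

/-- The dual graph of a net. -/
def Net.dual (N : P.Net) : SimpleGraph (Fin 4) := P.dualGraph N.place

/-- The list of faces `L` is the vertex sequence of a path with at least two vertices in the dual
graph of the net `N`. -/
def Net.HasLandscape (N : P.Net) (L : List (Fin 4)) : Prop :=
  2 ≤ L.length ∧ L.Nodup ∧ L.IsChain N.dual.Adj

/-- The region of the plane covered by the faces of `L` in the net `N`. -/
def Net.region (N : P.Net) (L : List (Fin 4)) : Set (EuclideanSpace ℝ (Fin 2)) :=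
  ⋃ n ∈ L, N.place n '' P.face n

variable (P)

/-- A landscape, given by the sequence of its faces: a path of at least two vertices in the dual
graph of some net. A list and its reversal give the same landscape. -/
def IsLandscape (L : List (Fin 4)) : Prop := ∃ N : P.Net, N.HasLandscape L

/-- `L` is a landscape with origin face `F m` and destination face `F n`. As the path is listed
from its origin, distinct lists are distinct landscapes here. -/
def IsLandscapeFromTo (m n : Fin 4) (L : List (Fin 4)) : Prop :=
  P.IsLandscape L ∧ L.head? = some m ∧ L.getLast? = some n

/-- The length of the trail in the landscape `L` from the copy of `p` in its face `F k` to the copy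
of `q` in its face `F l`: the length of the straight segment between them when `L` is laid out in
the plane, if this segment lies within `L`, and `∞` otherwise. All the nets in which `L` occurs give
congruent layouts of `L`, so the infimum is over a set with at most one element. -/
def trailLength (L : List (Fin 4)) (k l : Fin 4) (p q : EuclideanSpace ℝ (Fin 3)) : ENNReal :=
  ⨅ (N : P.Net) (_ : N.HasLandscape L)
    (_ : segment ℝ (N.place k p) (N.place l q) ⊆ N.region L), edist (N.place k p) (N.place l q)

/-- `M` is a sublandscape of `L`: its path is part of the path of `L`. -/
def IsSublandscape (M L : List (Fin 4)) : Prop := M <:+: L ∨ M.reverse <:+: L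

/-- The landscape `L` is valid: there are points `p`, `q` of `L`, lying in its faces `F k` and
`F l`, whose trail in `L` realizes the surface distance, while no other landscape in which `p` and
`q` have a trail of the same length is a sublandscape of `L`. -/
def IsValid (L : List (Fin 4)) : Prop :=
  P.IsLandscape L ∧ ∃ k ∈ L, ∃ l ∈ L, ∃ p ∈ P.face k, ∃ q ∈ P.face l,
    P.trailLength L k l p q = P.surfaceDist p q ∧
    ∀ M, P.IsLandscape M → M ≠ L → M ≠ L.reverse →
      ∀ k' ∈ M, ∀ l' ∈ M, p ∈ P.face k' → q ∈ P.face l' →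
        P.trailLength M k' l' p q = P.trailLength L k l p q → ¬ IsSublandscape M L

end UnitTetrahedron

end

/-! Rolling the tetrahedron over the plane prints its faces on the triangular lattice. The four
vertex classes are the four residue classes of the lattice modulo two, and every roll respects them.
The position of a printed face is therefore independent of the route up to very little: all copies
of a face arise from one of them by translations in twice the lattice and by a half-turn.

Lower bound. A path on the surface, however wild, unrolls to a planar displacement that is no longer
than the path and ends at some copy of the target (`exists_lift_along`, `exists_unrolling_of_path`).
The surface distance is thus at least the distance to the nearest copy. Nearest representatives
modulo two in each coordinate single out the five copies of the theorem. One further family of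
half-turned copies is dominated by the direct neighbour (`le_of_translation`, `le_of_rotation`,
`exists_len_le_eVariationOn`).

Upper bound. A landscape is a straight strip of two, three or four triangles: a rhombus, a trapezoid
or a parallelogram. Each is convex, so the segment between points of the end faces stays inside and
folds back to a path of the same length (`trail_two`, `trail_three`, `trail_four`). Strips are
realised by nets for every order of the faces (`exists_strip`), and any net containing a landscape
lays it out by rolling (`Net.place_eq_lift_roll`).

Validity needs only points interior to the two end faces whose shortest trail is the given one: a
sublandscape that contains both ends of a path is the whole path (`IsLandscapeFromTo.isValid`). -/

noncomputable section

open Finset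

namespace UnitTetrahedron

/-! ### Barycentric coordinates, isometric copies of faces, and rolling. -/

section Unfolding

variable {H : Type*} [NormedAddCommGroup H] [InnerProductSpace ℝ H]

/-- The norm of a combination with vanishing coefficient sum of points at mutual distance one. -/
theorem norm_sq_sum_smul {ι : Type*} [Fintype ι] {W : ι → H} {c : ι → ℝ}
    (hc : ∑ i, c i = 0)
    (hW : ∀ i j, i ≠ j → c i ≠ 0 → c j ≠ 0 → dist (W i) (W j) = 1) :
    ‖∑ i, c i • W i‖ ^ 2 = (∑ i, c i ^ 2) / 2 := by
  classical
  rw [← real_inner_self_eq_norm_sq, inner_sum_smul_sum_smul_of_sum_eq_zero W hc W hc]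
  have h : ∀ i j, c i * c j * (‖W i - W j‖ * ‖W i - W j‖) =
      c i * c j - if i = j then c i ^ 2 else 0 := by
    intro i j
    by_cases hij : i = j
    · subst hij; simp; ring
    · by_cases hi : c i = 0
      · simp [hi]
      by_cases hj : c j = 0
      · simp [hj, hij]
      rw [← dist_eq_norm, hW i j hij hi hj]; simp [hij]
  simp_rw [h, sum_sub_distrib, ← mul_sum, hc]
  simp

variable (P : UnitTetrahedron)

/-- The barycentric coordinates with respect to the vertices. -/
def bary (x : EuclideanSpace ℝ (Fin 3)) (j : Fin 4) : ℝ :=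
  (1 + ∑ k, (dist x (P.V k) ^ 2 - dist x (P.V j) ^ 2)) / 4

/-- With unit edges, the squared distance to `V k` is a constant minus `α k`. Summing the
differences of squared distances over `k` leaves `4 α j - 1`, which explains the formula for `bary`.
-/
theorem bary_sum_smul {α : Fin 4 → ℝ} (hα : ∑ i, α i = 1) :
    P.bary (∑ i, α i • P.V i) = α := by
  have h : ∀ k, dist (∑ i, α i • P.V i) (P.V k) ^ 2 = (∑ i, α i ^ 2 - 2 * α k + 1) / 2 := by
    intro k
    have h1 : ∑ i, α i • P.V i - P.V k = ∑ i, (α i - if i = k then 1 else 0) • P.V i := by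
      simp [sub_smul, sum_sub_distrib]
    rw [dist_eq_norm, h1, norm_sq_sum_smul _ (fun i j hij _ _ => P.dist_eq_one i j hij)]
    · congr 1
      have : ∀ i, (α i - if i = k then (1 : ℝ) else 0) ^ 2 =
          α i ^ 2 - (if i = k then 2 * α i else 0) + if i = k then 1 else 0 := by
        intro i; split_ifs <;> ring
      simp_rw [this, sum_add_distrib, sum_sub_distrib]
      simp
    · simp [sum_sub_distrib, hα]
  funext j
  simp only [bary, h]
  rw [Fin.sum_univ_four] at *
  linarith

theorem mem_face_iff {n : Fin 4} {x : EuclideanSpace ℝ (Fin 3)} :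
    x ∈ P.face n ↔ ∃ α : Fin 4 → ℝ, (∀ i, 0 ≤ α i) ∧ α n = 0 ∧ ∑ i, α i = 1 ∧
      ∑ i, α i • P.V i = x := by
  constructor
  · intro hx
    refine convexHull_min (t := {x | ∃ α : Fin 4 → ℝ, (∀ i, 0 ≤ α i) ∧ α n = 0 ∧ ∑ i, α i = 1 ∧
      ∑ i, α i • P.V i = x}) ?_ ?_ hx
    · rintro _ ⟨j, hj, rfl⟩
      exact ⟨Pi.single j 1, fun i => by by_cases h : i = j <;> simp [h],
        by simp [Ne.symm hj], by simp, by simp [Pi.single_apply]⟩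
    · rintro _ ⟨α, h1, h2, h3, rfl⟩ _ ⟨β, k1, k2, k3, rfl⟩ s t hs ht hst
      refine ⟨fun i => s * α i + t * β i, fun i => ?_, by simp [h2, k2], ?_, ?_⟩
      · have := h1 i; have := k1 i; positivity
      · simp [sum_add_distrib, ← mul_sum, h3, k3, hst]
      · simp [add_smul, sum_add_distrib, smul_sum, mul_smul]
  · rintro ⟨α, h1, h2, h3, rfl⟩
    have h4 : ∀ f : Fin 4 → EuclideanSpace ℝ (Fin 3),
        ∑ i, α i • f i = ∑ i ∈ univ.erase n, α i • f i := by
      intro f; rw [← add_sum_erase _ _ (mem_univ n)]; simp [h2]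
    rw [h4]
    refine (convex_convexHull ℝ _).sum_mem (fun i _ => h1 i) ?_ fun i hi =>
      subset_convexHull _ _ ⟨i, by simpa using hi, rfl⟩
    rw [← h3, ← add_sum_erase _ _ (mem_univ n), h2, zero_add]

variable {P}

theorem sum_smul_mem_face {n : Fin 4} {α : Fin 4 → ℝ} (h0 : ∀ i, 0 ≤ α i) (hn : α n = 0)
    (h1 : ∑ i, α i = 1) : ∑ i, α i • P.V i ∈ P.face n :=
  P.mem_face_iff.2 ⟨α, h0, hn, h1, rfl⟩

section

variable {n : Fin 4} {x : EuclideanSpace ℝ (Fin 3)} (hx : x ∈ P.face n)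

include hx

theorem bary_nonneg (i : Fin 4) : 0 ≤ P.bary x i := by
  obtain ⟨α, h1, -, h3, rfl⟩ := P.mem_face_iff.1 hx
  rw [P.bary_sum_smul h3]; exact h1 i

theorem bary_self : P.bary x n = 0 := by
  obtain ⟨α, -, h2, h3, rfl⟩ := P.mem_face_iff.1 hx
  rw [P.bary_sum_smul h3]; exact h2

theorem sum_bary : ∑ i, P.bary x i = 1 := by
  obtain ⟨α, -, -, h3, rfl⟩ := P.mem_face_iff.1 hx
  rw [P.bary_sum_smul h3]; exact h3

theorem sum_bary_smul : ∑ i, P.bary x i • P.V i = x := by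
  obtain ⟨α, -, -, h3, rfl⟩ := P.mem_face_iff.1 hx
  rw [P.bary_sum_smul h3]

end

theorem vertex_mem_face {i n : Fin 4} (h : i ≠ n) : P.V i ∈ P.face n :=
  subset_convexHull _ _ ⟨i, h, rfl⟩

variable (P)

theorem bary_vertex (i : Fin 4) : P.bary (P.V i) = Pi.single i 1 := by
  have := P.bary_sum_smul (α := Pi.single i 1) (by simp)
  simpa [Pi.single_apply] using this

/-- The affine map sending the vertex `V i` to `W i`, for all `i`. -/
def lift (W : Fin 4 → H) (x : EuclideanSpace ℝ (Fin 3)) : H := ∑ i, P.bary x i • W i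

theorem lift_vertex (W : Fin 4 → H) (i : Fin 4) : P.lift W (P.V i) = W i := by
  simp [lift, bary_vertex, Pi.single_apply]

/-- `W` puts the vertices of the face `F n` at mutual distance one. -/
def IsFrame (n : Fin 4) (W : Fin 4 → H) : Prop :=
  ∀ i j, i ≠ n → j ≠ n → i ≠ j → dist (W i) (W j) = 1

variable {P}

/-- The difference of two points of a face is a combination of vertices with coefficient sum zero
and no `n` term. Its norm depends on the coefficients alone, hence is the same for `W` and for the
true vertices. -/
theorem dist_lift {n : Fin 4} {W : Fin 4 → H} (hW : IsFrame n W)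
    {x y : EuclideanSpace ℝ (Fin 3)} (hx : x ∈ P.face n) (hy : y ∈ P.face n) :
    dist (P.lift W x) (P.lift W y) = dist x y := by
  have h0 : ∑ i, (P.bary x i - P.bary y i) = 0 := by
    rw [sum_sub_distrib, sum_bary hx, sum_bary hy, sub_self]
  have hne : ∀ i, P.bary x i - P.bary y i ≠ 0 → i ≠ n := by
    rintro i hi rfl; exact hi (by rw [bary_self hx, bary_self hy, sub_self])
  have h1 := norm_sq_sum_smul h0 (fun i j hij hi hj => hW i j (hne i hi) (hne j hj) hij)
  have h2 := norm_sq_sum_smul h0 (fun i j hij _ _ => P.dist_eq_one i j hij)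
  simp only [sub_smul, sum_sub_distrib, sum_bary_smul hx, sum_bary_smul hy] at h1 h2
  rw [dist_eq_norm, dist_eq_norm]
  exact (sq_eq_sq₀ (norm_nonneg _) (norm_nonneg _)).1 (h1.trans h2.symm)

omit [InnerProductSpace ℝ H] in
theorem isFrame_of_isometric {n : Fin 4} {g : EuclideanSpace ℝ (Fin 3) → H}
    (hg : ∀ a ∈ P.face n, ∀ b ∈ P.face n, dist (g a) (g b) = dist a b) :
    IsFrame n (g ∘ P.V) := fun i j hi hj hij => by
  rw [Function.comp, Function.comp, hg _ (vertex_mem_face hi) _ (vertex_mem_face hj),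
    P.dist_eq_one i j hij]

/-- Leibniz's formula: the distance from `z` to a barycentric combination is determined by the
distances among `z` and the `W i`. Here `W` is arbitrary, so that true vertices and their images can
be compared. -/
theorem norm_sq_sub_lift {n : Fin 4} {x : EuclideanSpace ℝ (Fin 3)} (hx : x ∈ P.face n)
    (W : Fin 4 → H) (z : H) :
    ‖z - P.lift W x‖ ^ 2 = (∑ i, P.bary x i * ‖z - W i‖ ^ 2) -
      (∑ i, ∑ j, P.bary x i * P.bary x j * ‖W i - W j‖ ^ 2) / 2 := by
  have h1 : z - P.lift W x = ∑ i, P.bary x i • (z - W i) := by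
    simp [smul_sub, sum_sub_distrib, ← sum_smul, sum_bary hx, lift]
  have h2 : ∀ i j, inner ℝ (z - W i) (z - W j) =
      (‖z - W i‖ ^ 2 + ‖z - W j‖ ^ 2 - ‖W i - W j‖ ^ 2) / 2 := by
    intro i j
    have h := norm_sub_sq_real (z - W i) (z - W j)
    rw [sub_sub_sub_cancel_left, norm_sub_rev] at h
    linarith
  have hs := sum_bary hx
  rw [h1, ← real_inner_self_eq_norm_sq, sum_inner]
  simp_rw [inner_sum, real_inner_smul_left, real_inner_smul_right, h2]
  rw [Fin.sum_univ_four] at hs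
  have h4 : P.bary x 3 = 1 - P.bary x 0 - P.bary x 1 - P.bary x 2 := by linarith
  simp only [Fin.sum_univ_four, h4]
  ring

/-- An isometric map of a face is affine. -/
theorem eq_lift_of_isometric {n : Fin 4} {g : EuclideanSpace ℝ (Fin 3) → H}
    (hg : ∀ a ∈ P.face n, ∀ b ∈ P.face n, dist (g a) (g b) = dist a b)
    {x : EuclideanSpace ℝ (Fin 3)} (hx : x ∈ P.face n) : g x = P.lift (g ∘ P.V) x := by
  -- The right-hand sides of `h1` and `h2` agree term by term, since `g` keeps distances and the
  -- weight at `n` is zero. The left-hand side of `h2` is zero.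
  have h1 := norm_sq_sub_lift hx (g ∘ P.V) (g x)
  have h2 := norm_sq_sub_lift hx P.V x
  have h3 : P.lift P.V x = x := sum_bary_smul hx
  have e1 : ∀ i, P.bary x i * ‖g x - (g ∘ P.V) i‖ ^ 2 = P.bary x i * ‖x - P.V i‖ ^ 2 := by
    intro i
    by_cases hi : i = n
    · simp [hi, bary_self hx]
    · rw [← dist_eq_norm, ← dist_eq_norm, Function.comp, hg _ hx _ (vertex_mem_face hi)]
  have e2 : ∀ i j, P.bary x i * P.bary x j * ‖(g ∘ P.V) i - (g ∘ P.V) j‖ ^ 2 =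
      P.bary x i * P.bary x j * ‖P.V i - P.V j‖ ^ 2 := by
    intro i j
    by_cases hi : i = n
    · simp [hi, bary_self hx]
    by_cases hj : j = n
    · simp [hj, bary_self hx]
    rw [← dist_eq_norm, ← dist_eq_norm, Function.comp, Function.comp,
      hg _ (vertex_mem_face hi) _ (vertex_mem_face hj)]
  simp_rw [e1, e2] at h1
  rw [← h2, h3, sub_self, norm_zero] at h1
  rw [← sub_eq_zero, ← norm_eq_zero]
  nlinarith [norm_nonneg (g x - P.lift (g ∘ P.V) x)]

/-- Rolling over from the face `F n` to the face `F m` in the plane: the copy of the vertex `V n`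
in the new face is the mirror image of the copy of `V m` in the old one. -/
def roll {A : Type*} [AddCommGroup A] (W : Fin 4 → A) (n m : Fin 4) : Fin 4 → A :=
  Function.update W n (∑ k, W k - W n - W m - W m)

theorem sum_four {A : Type*} [AddCommMonoid A] {a b c d : Fin 4} (h : [a, b, c, d].Nodup)
    (f : Fin 4 → A) : ∑ i, f i = f a + f b + f c + f d := by
  have : (univ : Finset (Fin 4)) = {a, b, c, d} := by
    revert a b c d; decide
  simp only [List.nodup_cons, List.mem_cons, List.not_mem_nil, or_false, not_or] at h
  rw [this, sum_insert (by simp; tauto), sum_insert (by simp; tauto), sum_insert (by simp; tauto),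
    sum_singleton]
  abel

theorem eq_of_nodup {a b c d : Fin 4} (h : [a, b, c, d].Nodup) (n : Fin 4) :
    n = a ∨ n = b ∨ n = c ∨ n = d := by
  revert a b c d n; decide

theorem exists_nodup {a b : Fin 4} (h : a ≠ b) : ∃ c d, [a, b, c, d].Nodup := by
  revert a b; decide

/-- The sum in `roll` avoids choosing names for the two ends of the hinge edge. The target is any
additive group, so that lattice points can be rolled as well as points of the plane. -/
theorem roll_apply_self {A : Type*} [AddCommGroup A] (W : Fin 4 → A) {n m i j : Fin 4}
    (h : [n, m, i, j].Nodup) : roll W n m n = W i + W j - W m := by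
  rw [roll, Function.update_self, sum_four h]; abel

theorem roll_apply_of_ne {A : Type*} [AddCommGroup A] (W : Fin 4 → A) {n m i : Fin 4}
    (h : i ≠ n) : roll W n m i = W i := by
  rw [roll, Function.update_of_ne h]

omit [InnerProductSpace ℝ H] in
theorem IsFrame.roll {n m : Fin 4} {W : Fin 4 → H} (hW : IsFrame n W) (h : n ≠ m) :
    IsFrame m (roll W n m) := by
  obtain ⟨i, j, hd⟩ := exists_nodup h
  have hn := roll_apply_self W hd
  simp only [List.nodup_cons, List.mem_cons, List.not_mem_nil, or_false, not_or] at hd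
  obtain ⟨⟨-, ni, nj⟩, ⟨mi, mj⟩, ij, -⟩ := hd
  have d1 : dist (UnitTetrahedron.roll W n m n) (W i) = 1 := by
    rw [hn, ← hW j m (Ne.symm nj) h.symm (Ne.symm mj), dist_eq_norm, dist_eq_norm]; congr 1; abel
  have d2 : dist (UnitTetrahedron.roll W n m n) (W j) = 1 := by
    rw [hn, ← hW i m (Ne.symm ni) h.symm (Ne.symm mi), dist_eq_norm, dist_eq_norm]; congr 1; abel
  have key : ∀ k, k ≠ n → k ≠ m → dist (UnitTetrahedron.roll W n m n) (W k) = 1 := by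
    intro k h1 h2
    have : k = i ∨ k = j := by
      clear d1 d2 hn hW; revert n m i j k; decide
    rcases this with rfl | rfl <;> assumption
  intro k l hk hl hkl
  by_cases h1 : k = n
  · subst h1
    rw [roll_apply_of_ne W (Ne.symm hkl)]; exact key l (Ne.symm hkl) hl
  by_cases h2 : l = n
  · subst h2
    rw [roll_apply_of_ne W hkl, dist_comm]; exact key k hkl hk
  rw [roll_apply_of_ne W h1, roll_apply_of_ne W h2]
  exact hW k l h1 h2 hkl

theorem lift_congr {n : Fin 4} {W W' : Fin 4 → H} (h : ∀ i, i ≠ n → W i = W' i)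
    {x : EuclideanSpace ℝ (Fin 3)} (hx : x ∈ P.face n) : P.lift W x = P.lift W' x := by
  refine sum_congr rfl fun i _ => ?_
  by_cases hi : i = n
  · simp [hi, bary_self hx]
  · rw [h i hi]

theorem lift_roll {n : Fin 4} {W : Fin 4 → H} (m : Fin 4)
    {x : EuclideanSpace ℝ (Fin 3)} (hx : x ∈ P.face n) :
    P.lift (roll W n m) x = P.lift W x :=
  lift_congr (fun _ hi => roll_apply_of_ne W hi) hx

end Unfolding

end UnitTetrahedron

end

noncomputable section

open Finset

namespace UnitTetrahedron

/-! ### Orientation in space and in the plane. -/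

section Orientation

variable (P : UnitTetrahedron)

/-- Six times the signed volume of the tetrahedron with the vertices in the given order. -/
def orient (n u v w : Fin 4) : ℝ :=
  (Matrix.of fun i j : Fin 3 => (![P.V v - P.V u, P.V w - P.V u, P.V n - P.V u] i) j).det

theorem orient_eq (n u v w : Fin 4) : P.orient n u v w =
    (P.V v 0 - P.V u 0) * (P.V w 1 - P.V u 1) * (P.V n 2 - P.V u 2) -
    (P.V v 0 - P.V u 0) * (P.V w 2 - P.V u 2) * (P.V n 1 - P.V u 1) -
    (P.V v 1 - P.V u 1) * (P.V w 0 - P.V u 0) * (P.V n 2 - P.V u 2) +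
    (P.V v 1 - P.V u 1) * (P.V w 2 - P.V u 2) * (P.V n 0 - P.V u 0) +
    (P.V v 2 - P.V u 2) * (P.V w 0 - P.V u 0) * (P.V n 1 - P.V u 1) -
    (P.V v 2 - P.V u 2) * (P.V w 1 - P.V u 1) * (P.V n 0 - P.V u 0) := by
  simp [orient, Matrix.det_fin_three]

theorem orient_swap_mid (n u v w : Fin 4) : P.orient n v u w = -P.orient n u v w := by
  simp only [orient_eq]; ring

theorem orient_swap_right (n u v w : Fin 4) : P.orient n u w v = -P.orient n u v w := by
  simp only [orient_eq]; ring

/-- The square of the determinant is the Gram determinant with `1` on the diagonal and `1/2`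
elsewhere, which is `1/2`. -/
theorem orient_ne_zero {n u v w : Fin 4} (h : [n, u, v, w].Nodup) : P.orient n u v w ≠ 0 := by
  have hd : ∀ i j, i ≠ j → (P.V i 0 - P.V j 0) ^ 2 + (P.V i 1 - P.V j 1) ^ 2 +
      (P.V i 2 - P.V j 2) ^ 2 = 1 := by
    intro i j hij
    have := P.dist_eq_one i j hij
    rw [EuclideanSpace.dist_eq, Real.sqrt_eq_one, Fin.sum_univ_three] at this
    simpa [Real.dist_eq, sq_abs] using this
  simp only [List.nodup_cons, List.mem_cons, List.not_mem_nil, or_false, not_or] at h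
  obtain ⟨⟨nu, nv, nw⟩, ⟨uv, uw⟩, vw, -⟩ := h
  have h1 := hd v u (Ne.symm uv)
  have h2 := hd w u (Ne.symm uw)
  have h3 := hd n u nu
  have h4 := hd v w vw
  have h5 := hd n v nv
  have h6 := hd n w nw
  intro h0
  rw [orient_eq] at h0
  generalize P.V v = v at *
  generalize P.V u = u at *
  generalize P.V w = w at *
  generalize P.V n = n at *
  obtain ⟨a0, ha0⟩ : ∃ a, a = v 0 - u 0 := ⟨_, rfl⟩
  obtain ⟨a1, ha1⟩ : ∃ a, a = v 1 - u 1 := ⟨_, rfl⟩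
  obtain ⟨a2, ha2⟩ : ∃ a, a = v 2 - u 2 := ⟨_, rfl⟩
  obtain ⟨b0, hb0⟩ : ∃ a, a = w 0 - u 0 := ⟨_, rfl⟩
  obtain ⟨b1, hb1⟩ : ∃ a, a = w 1 - u 1 := ⟨_, rfl⟩
  obtain ⟨b2, hb2⟩ : ∃ a, a = w 2 - u 2 := ⟨_, rfl⟩
  obtain ⟨c0, hc0⟩ : ∃ a, a = n 0 - u 0 := ⟨_, rfl⟩
  obtain ⟨c1, hc1⟩ : ∃ a, a = n 1 - u 1 := ⟨_, rfl⟩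
  obtain ⟨c2, hc2⟩ : ∃ a, a = n 2 - u 2 := ⟨_, rfl⟩
  have eab : a0 * b0 + a1 * b1 + a2 * b2 = 1 / 2 := by
    subst_vars
    linear_combination (h1 + h2 - h4) / 2
  have eac : a0 * c0 + a1 * c1 + a2 * c2 = 1 / 2 := by
    subst_vars
    linear_combination (h1 + h3 - h5) / 2
  have ebc : b0 * c0 + b1 * c1 + b2 * c2 = 1 / 2 := by
    subst_vars
    linear_combination (h2 + h3 - h6) / 2
  rw [← ha0, ← ha1, ← ha2] at h1
  rw [← hb0, ← hb1, ← hb2] at h2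
  rw [← hc0, ← hc1, ← hc2] at h3
  simp only [← ha0, ← ha1, ← ha2, ← hb0, ← hb1, ← hb2, ← hc0, ← hc1, ← hc2] at h0
  have gram : (a0 * b1 * c2 - a0 * b2 * c1 - a1 * b0 * c2 + a1 * b2 * c0 + a2 * b0 * c1 -
      a2 * b1 * c0) ^ 2 = (a0 ^ 2 + a1 ^ 2 + a2 ^ 2) * (b0 ^ 2 + b1 ^ 2 + b2 ^ 2) *
        (c0 ^ 2 + c1 ^ 2 + c2 ^ 2) +
      2 * (a0 * b0 + a1 * b1 + a2 * b2) * (a0 * c0 + a1 * c1 + a2 * c2) *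
        (b0 * c0 + b1 * c1 + b2 * c2) -
      (a0 ^ 2 + a1 ^ 2 + a2 ^ 2) * (b0 * c0 + b1 * c1 + b2 * c2) ^ 2 -
      (b0 ^ 2 + b1 ^ 2 + b2 ^ 2) * (a0 * c0 + a1 * c1 + a2 * c2) ^ 2 -
      (c0 ^ 2 + c1 ^ 2 + c2 ^ 2) * (a0 * b0 + a1 * b1 + a2 * b2) ^ 2 := by ring
  rw [h0, h1, h2, h3, eab, eac, ebc] at gram
  norm_num at gram

theorem ccw_iff {n u v w : Fin 4} : P.CCW n u v w ↔ [n, u, v, w].Nodup ∧ P.orient n u v w < 0 :=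
  Iff.rfl

theorem ccw_or_ccw {n u v w : Fin 4} (h : [n, u, v, w].Nodup) :
    P.CCW n u v w ∨ P.CCW n u w v := by
  rcases lt_or_gt_of_ne (P.orient_ne_zero h) with h1 | h1
  · exact Or.inl ⟨h, h1⟩
  · exact Or.inr ⟨by revert h; clear h1; revert n u v w; decide, by
      change P.orient n u w v < 0
      rw [orient_swap_right]; linarith⟩

variable {P}

theorem CCW.rotate {n u v w : Fin 4} (h : P.CCW n u v w) : P.CCW n v w u := by
  rw [ccw_iff] at *
  refine ⟨by have := h.1; clear h; revert n u v w; decide, ?_⟩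
  rw [orient_swap_right, orient_swap_mid]; linarith [h.2]

/-- A double transposition keeps the sign: the two faces at an edge run through it in opposite
directions. -/
theorem CCW.swap {n u v w : Fin 4} (h : P.CCW n u v w) : P.CCW w v u n := by
  rw [ccw_iff] at *
  refine ⟨by have := h.1; clear h; revert n u v w; decide, ?_⟩
  rw [show P.orient w v u n = P.orient n u v w by simp only [orient_eq]; ring]
  exact h.2

theorem CCW.not_swap {n u v w : Fin 4} (h : P.CCW n u v w) : ¬ P.CCW n v u w := by
  rw [ccw_iff] at *
  rw [orient_swap_mid]
  intro h'
  linarith [h.2, h'.2]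

theorem CCW.eq_of_ccw {n u v u' v' m : Fin 4} (h : P.CCW n u v m) (h' : P.CCW n u' v' m) :
    u' = u ∧ v' = v := by
  have h1 := h.1
  have h2 := h'.1
  have : (u' = u ∧ v' = v) ∨ (u' = v ∧ v' = u) := by
    clear h h'; revert n u v u' v' m; decide
  rcases this with h3 | ⟨rfl, rfl⟩
  · exact h3
  · exact absurd h' h.not_swap

/-- Twice the signed area of a triangle in the plane. -/
def area (x y z : EuclideanSpace ℝ (Fin 2)) : ℝ :=
  (y - x) 0 * (z - x) 1 - (y - x) 1 * (z - x) 0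

theorem area_rotate (x y z : EuclideanSpace ℝ (Fin 2)) : area y z x = area x y z := by
  simp only [area, PiLp.sub_apply]; ring

theorem area_swap (x y z : EuclideanSpace ℝ (Fin 2)) : area y x z = -area x y z := by
  simp only [area, PiLp.sub_apply]; ring

theorem area_reflect (x y z : EuclideanSpace ℝ (Fin 2)) : area x y (x + y - z) = -area x y z := by
  simp only [area, PiLp.sub_apply, PiLp.add_apply]; ring

theorem dist_sq_plane (x y : EuclideanSpace ℝ (Fin 2)) :
    dist x y ^ 2 = (x 0 - y 0) ^ 2 + (x 1 - y 1) ^ 2 := by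
  rw [EuclideanSpace.dist_eq, Real.sq_sqrt (by positivity), Fin.sum_univ_two]
  simp [Real.dist_eq, sq_abs]

/-- Two equilateral triangles on opposite sides of a common edge are mirror images. -/
theorem eq_reflect_of_area {x y z z' : EuclideanSpace ℝ (Fin 2)} (hxy : dist x y = 1)
    (hxz : dist x z = 1) (hyz : dist y z = 1) (hxz' : dist x z' = 1) (hyz' : dist y z' = 1)
    (h : 0 < area x y z) (h' : area x y z' < 0) : z' = x + y - z := by
  have a1 := dist_sq_plane x y
  have a2 := dist_sq_plane x z
  have a3 := dist_sq_plane y z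
  have a4 := dist_sq_plane x z'
  have a5 := dist_sq_plane y z'
  rw [hxy] at a1; rw [hxz] at a2; rw [hyz] at a3; rw [hxz'] at a4; rw [hyz'] at a5
  simp only [area, PiLp.sub_apply] at h h'
  obtain ⟨u0, hu0⟩ : ∃ a, a = y 0 - x 0 := ⟨_, rfl⟩
  obtain ⟨u1, hu1⟩ : ∃ a, a = y 1 - x 1 := ⟨_, rfl⟩
  obtain ⟨v0, hv0⟩ : ∃ a, a = z 0 - x 0 := ⟨_, rfl⟩
  obtain ⟨v1, hv1⟩ : ∃ a, a = z 1 - x 1 := ⟨_, rfl⟩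
  obtain ⟨w0, hw0⟩ : ∃ a, a = z' 0 - x 0 := ⟨_, rfl⟩
  obtain ⟨w1, hw1⟩ : ∃ a, a = z' 1 - x 1 := ⟨_, rfl⟩
  rw [← hu0, ← hu1, ← hv0, ← hv1] at h
  rw [← hu0, ← hu1, ← hw0, ← hw1] at h'
  have b1 : u0 ^ 2 + u1 ^ 2 = 1 := by subst_vars; linarith
  have b2 : v0 ^ 2 + v1 ^ 2 = 1 := by subst_vars; linarith
  have b3 : w0 ^ 2 + w1 ^ 2 = 1 := by subst_vars; linarith
  have b4 : u0 * v0 + u1 * v1 = 1 / 2 := by subst_vars; linear_combination -(a1 + a2 - a3) / 2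
  have b5 : u0 * w0 + u1 * w1 = 1 / 2 := by subst_vars; linear_combination -(a1 + a4 - a5) / 2
  have c1 : (u0 * v1 - u1 * v0) ^ 2 = 3 / 4 := by
    have : (u0 * v1 - u1 * v0) ^ 2 =
      (u0 ^ 2 + u1 ^ 2) * (v0 ^ 2 + v1 ^ 2) - (u0 * v0 + u1 * v1) ^ 2 := by ring
    rw [this, b1, b2, b4]; norm_num
  have c2 : (u0 * w1 - u1 * w0) ^ 2 = 3 / 4 := by
    have : (u0 * w1 - u1 * w0) ^ 2 =
      (u0 ^ 2 + u1 ^ 2) * (w0 ^ 2 + w1 ^ 2) - (u0 * w0 + u1 * w1) ^ 2 := by ring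
    rw [this, b1, b3, b5]; norm_num
  have c3 : (u0 * v1 - u1 * v0) + (u0 * w1 - u1 * w0) = 0 := by
    have : ((u0 * v1 - u1 * v0) + (u0 * w1 - u1 * w0)) *
      ((u0 * v1 - u1 * v0) - (u0 * w1 - u1 * w0)) = 0 := by ring_nf at c1 c2 ⊢; linarith
    rcases mul_eq_zero.1 this with h1 | h1
    · exact h1
    · linarith
  -- The vector `v + w - u` has zero dot product with the unit vector `u` by `b4`, `b5`, `b1`, and
  -- zero cross product by `c3`. So both coordinates vanish.
  have d0 : v0 + w0 - u0 = 0 := by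
    linear_combination (-(v0 + w0 - u0)) * b1 + u0 * (b4 + b5 - b1) - u1 * c3
  have d1 : v1 + w1 - u1 = 0 := by
    linear_combination (-(v1 + w1 - u1)) * b1 + u1 * (b4 + b5 - b1) + u0 * c3
  ext i
  fin_cases i
  · simp only [Fin.zero_eta, PiLp.sub_apply, PiLp.add_apply]; linarith
  · simp only [Fin.mk_one, PiLp.sub_apply, PiLp.add_apply]; linarith

end Orientation

/-! ### Glued faces of a net are related by rolling. -/

section Nets

variable {P : UnitTetrahedron}

theorem Net.isFrame (N : P.Net) (n : Fin 4) : IsFrame n (N.place n ∘ P.V) :=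
  isFrame_of_isometric (N.isometric n)

theorem Net.place_eq_lift (N : P.Net) {n : Fin 4} {x : EuclideanSpace ℝ (Fin 3)}
    (hx : x ∈ P.face n) : N.place n x = P.lift (N.place n ∘ P.V) x :=
  eq_lift_of_isometric (N.isometric n) hx

theorem Net.area_pos (N : P.Net) {n u v w : Fin 4} (h : P.CCW n u v w) :
    0 < area (N.place n (P.V u)) (N.place n (P.V v)) (N.place n (P.V w)) :=
  N.preserves_rotation n u v w h

/-- Faces glued together in a net are copied into the plane by rolling from one to the other. -/
theorem Net.place_eq_lift_roll (N : P.Net) {n m : Fin 4} (h : N.dual.Adj n m)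
    {W : Fin 4 → EuclideanSpace ℝ (Fin 2)} (hW : ∀ i, i ≠ n → N.place n (P.V i) = W i) {i : Fin 4}
    (hi : i ≠ m) : N.place m (P.V i) = roll W n m i := by
  obtain ⟨hne, hglue⟩ := h
  have hv : ∀ j, j ≠ n → j ≠ m → N.place m (P.V j) = W j := fun j h1 h2 => by
    rw [← hW j h1, hglue _ ⟨vertex_mem_face h1, vertex_mem_face h2⟩]
  by_cases hin : i = n
  swap
  · rw [roll_apply_of_ne _ hin, hv i hin hi]
  subst hin
  obtain ⟨u, v, hd⟩ : ∃ u v, P.CCW i u v m := by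
    obtain ⟨u, v, hd⟩ := exists_nodup hne
    rcases P.ccw_or_ccw (n := i) (u := m) (v := u) (w := v) hd with h1 | h1
    · exact ⟨u, v, h1.rotate⟩
    · exact ⟨v, u, h1.rotate⟩
  have hd' := hd.1
  rw [roll_apply_self W (i := u) (j := v) (by clear hd hglue hW hv hne hi; revert i m u v; decide)]
  have n1 := N.area_pos hd
  have n2 := N.area_pos hd.swap
  simp only [List.nodup_cons, List.mem_cons, List.not_mem_nil, or_false, not_or] at hd'
  obtain ⟨⟨iu, iv, -⟩, ⟨uv, um⟩, vm, -⟩ := hd'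
  have f1 := N.isFrame i
  have f2 := N.isFrame m
  rw [area_swap, hv u (Ne.symm iu) um, hv v (Ne.symm iv) vm] at n2
  rw [hW u (Ne.symm iu), hW v (Ne.symm iv), hW m hne.symm] at n1
  refine eq_reflect_of_area (x := W u) (y := W v) ?_ ?_ ?_ ?_ ?_ n1 (by linarith)
  · rw [← hW u (Ne.symm iu), ← hW v (Ne.symm iv)]; exact f1 u v (Ne.symm iu) (Ne.symm iv) uv
  · rw [← hW u (Ne.symm iu), ← hW m hne.symm]; exact f1 u m (Ne.symm iu) hne.symm um
  · rw [← hW m hne.symm, ← hW v (Ne.symm iv)]; exact f1 v m (Ne.symm iv) hne.symm vm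
  · rw [← hv u (Ne.symm iu) um]; exact f2 u i um hi (Ne.symm iu)
  · rw [← hv v (Ne.symm iv) vm]; exact f2 v i vm hi (Ne.symm iv)

end Nets

end UnitTetrahedron

end

noncomputable section

open Finset

namespace UnitTetrahedron

/-! ### Nets in the form of a strip. -/

section Strip

theorem map_roll {A B F : Type*} [AddCommGroup A] [AddCommGroup B] [FunLike F A B]
    [AddMonoidHomClass F A B] (f : F) (W : Fin 4 → A) (n m i : Fin 4) :
    f (roll W n m i) = roll (fun j => f (W j)) n m i := by
  by_cases h : i = n
  · subst h; simp [roll]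
  · rw [roll_apply_of_ne _ h, roll_apply_of_ne _ h]

section RollValues

variable {A : Type*} [AddCommGroup A] (W : Fin 4 → A) {a b c d : Fin 4}
  (h : [a, b, c, d].Nodup)

include h

theorem roll_roll_apply : roll (roll W a b) b c a = W c + W d - W b ∧
    roll (roll W a b) b c b = W d + W d - W b ∧ roll (roll W a b) b c d = W d := by
  have h1 : roll W a b a = W c + W d - W b := roll_apply_self W h
  have h2 : roll (roll W a b) b c b = roll W a b a + roll W a b d - roll W a b c :=
    roll_apply_self _ (by clear h1; revert a b c d; decide)
  simp only [List.nodup_cons, List.mem_cons, List.not_mem_nil, or_false, not_or] at h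
  rw [h2, roll_apply_of_ne _ (i := a) (by tauto), roll_apply_of_ne _ (i := d) (n := b) (by tauto),
    roll_apply_of_ne W (i := d) (by tauto), roll_apply_of_ne W (i := c) (by tauto), h1]
  exact ⟨rfl, by abel, rfl⟩

theorem roll_roll_roll_apply : roll (roll (roll W a b) b c) c d a = W c + W d - W b ∧
    roll (roll (roll W a b) b c) c d b = W d + W d - W b ∧
    roll (roll (roll W a b) b c) c d c = W c + W d + W d - W b - W b := by
  obtain ⟨h1, h2, h3⟩ := roll_roll_apply W h
  have h4 : roll (roll (roll W a b) b c) c d c = roll (roll W a b) b c a +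
      roll (roll W a b) b c b - roll (roll W a b) b c d :=
    roll_apply_self _ (by clear h1 h2 h3; revert a b c d; decide)
  simp only [List.nodup_cons, List.mem_cons, List.not_mem_nil, or_false, not_or] at h
  rw [h4, roll_apply_of_ne _ (n := c) (i := a) (by tauto),
    roll_apply_of_ne _ (n := c) (i := b) (by tauto), h1, h2, h3]
  exact ⟨rfl, rfl, by abel⟩

end RollValues

variable {P : UnitTetrahedron}

/-- A common interior point would have `l = k`, and so would all points near it, but moving along
`v` changes `l`. -/
theorem disjoint_interior_of_separated {H : Type*} [NormedAddCommGroup H] [NormedSpace ℝ H]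
    (l : H →ₗ[ℝ] ℝ) {v : H} (hv : l v ≠ 0) {k : ℝ} {A B : Set H} (hA : ∀ z ∈ A, l z ≤ k)
    (hB : ∀ z ∈ B, k ≤ l z) : Disjoint (interior A) (interior B) := by
  rw [Set.disjoint_left]
  intro z hzA hzB
  have ht : Filter.Tendsto (fun r : ℝ => z + r • v) (nhdsWithin 0 {0}ᶜ) (nhds z) := by
    have : Continuous fun r : ℝ => z + r • v := by fun_prop
    simpa using (this.tendsto 0).mono_left nhdsWithin_le_nhds
  have h1 := ht.eventually (isOpen_interior.mem_nhds hzA)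
  have h2 := ht.eventually (isOpen_interior.mem_nhds hzB)
  obtain ⟨r, ⟨hr1, hr2⟩, hr3⟩ := ((h1.and h2).and self_mem_nhdsWithin).exists
  have e1 : l (z + r • v) = k := le_antisymm (hA _ (interior_subset hr1)) (hB _ (interior_subset hr2))
  have e2 : l z = k := le_antisymm (hA _ (interior_subset hzA)) (hB _ (interior_subset hzB))
  rw [map_add, map_smul, e2, add_eq_left, smul_eq_mul] at e1
  exact (mul_ne_zero hr3 hv) e1

theorem apply_lift_le {H : Type*} [NormedAddCommGroup H] [InnerProductSpace ℝ H]
    (l : H →ₗ[ℝ] ℝ) {k : ℝ} {n : Fin 4} {W : Fin 4 → H} (h : ∀ i, i ≠ n → l (W i) ≤ k)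
    {x : EuclideanSpace ℝ (Fin 3)} (hx : x ∈ P.face n) : l (P.lift W x) ≤ k := by
  rw [lift, map_sum]
  calc ∑ i, l (P.bary x i • W i) ≤ ∑ i, P.bary x i * k := by
        refine sum_le_sum fun i _ => ?_
        rw [map_smul, smul_eq_mul]
        by_cases hi : i = n
        · rw [hi, bary_self hx]; simp
        · exact mul_le_mul_of_nonneg_left (h i hi) (bary_nonneg hx i)
    _ = k := by rw [← sum_mul, sum_bary hx, one_mul]

theorem disjoint_interior_lift {H : Type*} [NormedAddCommGroup H] [InnerProductSpace ℝ H]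
    (l : H →ₗ[ℝ] ℝ) {v : H} (hv : l v ≠ 0) {k : ℝ} {n m : Fin 4} {W W' : Fin 4 → H}
    (h : ∀ i, i ≠ n → l (W i) ≤ k) (h' : ∀ i, i ≠ m → k ≤ l (W' i)) :
    Disjoint (interior (P.lift W '' P.face n)) (interior (P.lift W' '' P.face m)) := by
  refine disjoint_interior_of_separated l hv (k := k) ?_ ?_
  · rintro _ ⟨x, hx, rfl⟩
    exact apply_lift_le l h hx
  · rintro _ ⟨x, hx, rfl⟩
    have := apply_lift_le (P := P) (-l) (k := -k) (W := W') (n := m)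
      (fun i hi => by simpa using h' i hi) hx
    simpa using this

variable (P) in
/-- The triangle `W` of the face `F n` has the direction of rotation as seen from outside. -/
def IsOriented (n : Fin 4) (W : Fin 4 → EuclideanSpace ℝ (Fin 2)) : Prop :=
  ∀ u v w, P.CCW n u v w → 0 < area (W u) (W v) (W w)

theorem isOriented_of_ccw {n u v w : Fin 4} (h : P.CCW n u v w)
    {W : Fin 4 → EuclideanSpace ℝ (Fin 2)} (hW : 0 < area (W u) (W v) (W w)) :
    P.IsOriented n W := by
  intro u' v' w' h'
  have : w' = w ∨ u' = w ∨ v' = w := by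
    have h1 := h.1; have h2 := h'.1
    clear hW h h'; revert n u v w u' v' w'; decide
  rcases this with rfl | rfl | rfl
  · obtain ⟨rfl, rfl⟩ := h.eq_of_ccw h'; exact hW
  · obtain ⟨rfl, rfl⟩ := h.eq_of_ccw h'.rotate; rwa [area_rotate] at hW
  · obtain ⟨rfl, rfl⟩ := h.eq_of_ccw h'.rotate.rotate; rwa [area_rotate]

/-- Two sign changes cancel: mirroring the third vertex reverses the area, and the new face runs
through the common edge backwards. -/
theorem IsOriented.roll {n m : Fin 4} {W : Fin 4 → EuclideanSpace ℝ (Fin 2)}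
    (hW : P.IsOriented n W) (h : n ≠ m) : P.IsOriented m (roll W n m) := by
  obtain ⟨u, v, hc⟩ : ∃ u v, P.CCW m u v n := by
    obtain ⟨u, v, hd⟩ := exists_nodup h.symm
    rcases P.ccw_or_ccw (n := m) (u := n) (v := u) (w := v) hd with h1 | h1
    · exact ⟨u, v, h1.rotate⟩
    · exact ⟨v, u, h1.rotate⟩
  refine isOriented_of_ccw hc ?_
  have h1 := hW _ _ _ hc.swap
  have hd := hc.1
  rw [roll_apply_self W (i := u) (j := v) (by clear h1 hc hW h; revert n m u v; decide)]
  simp only [List.nodup_cons, List.mem_cons, List.not_mem_nil, or_false, not_or] at hd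
  rw [roll_apply_of_ne _ (by tauto), roll_apply_of_ne _ (by tauto), area_reflect, ← area_swap]
  exact h1

/-- The frames of four faces laid out in a strip. -/
def stripFrame {A : Type*} [AddCommGroup A] (W : Fin 4 → A) (a b c d n : Fin 4) : Fin 4 → A :=
  if n = a then W else if n = b then roll W a b else if n = c then roll (roll W a b) b c else
    roll (roll (roll W a b) b c) c d

/-- The functionals `s` and `t` are the linear coordinates with `W c` at the origin and `W b`, `W d`
as basis. They serve to separate the triangles of the strip. The sign of `η` carries the
orientation. -/
theorem exists_oriented_frame {a b c d : Fin 4} (h : [a, b, c, d].Nodup) :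
    ∃ W : Fin 4 → EuclideanSpace ℝ (Fin 2), IsFrame a W ∧
      P.IsOriented a W ∧ (∃ s : EuclideanSpace ℝ (Fin 2) →ₗ[ℝ] ℝ, s (W b) = 1 ∧ s (W c) = 0 ∧
        s (W d) = 0) ∧ (∃ t : EuclideanSpace ℝ (Fin 2) →ₗ[ℝ] ℝ, t (W b) = 0 ∧ t (W c) = 0 ∧
        t (W d) = 1) := by
  obtain ⟨η, hη, hη'⟩ : ∃ η : ℝ, η ^ 2 = 3 / 4 ∧ (P.CCW a c b d ∧ 0 < η ∨ P.CCW a b c d ∧ η < 0) := by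
    have h3 : √3 ^ 2 = (3 : ℝ) := Real.sq_sqrt (by norm_num)
    have h4 : 0 < √3 := by positivity
    have hcw : P.CCW a c b d ∨ P.CCW a b c d := by
      rcases P.ccw_or_ccw h with h1 | h1
      · exact Or.inr h1
      · exact Or.inl h1.rotate.rotate
    rcases hcw with h1 | h1
    · exact ⟨√3 / 2, by nlinarith, Or.inl ⟨h1, by linarith⟩⟩
    · exact ⟨-(√3 / 2), by nlinarith, Or.inr ⟨h1, by linarith⟩⟩
  have hη0 : η ≠ 0 := by rintro rfl; norm_num at hη
  let W : Fin 4 → EuclideanSpace ℝ (Fin 2) := fun i =>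
    if i = b then !₂[1, 0] else if i = d then !₂[1 / 2, η] else !₂[0, 0]
  have hd := h
  simp only [List.nodup_cons, List.mem_cons, List.not_mem_nil, or_false, not_or] at hd
  obtain ⟨⟨ab, ac, ad⟩, ⟨bc, bd⟩, cd, -⟩ := hd
  have Wb : W b = !₂[1, 0] := by simp [W]
  have Wd : W d = !₂[1 / 2, η] := by simp [W, Ne.symm bd]
  have Wc : W c = !₂[0, 0] := by simp [W, Ne.symm bc, cd]
  have dbc : dist (W b) (W c) = 1 := by
    rw [← sq_eq_sq₀ dist_nonneg zero_le_one, dist_sq_plane, Wb, Wc]; simp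
  have dbd : dist (W b) (W d) = 1 := by
    rw [← sq_eq_sq₀ dist_nonneg zero_le_one, dist_sq_plane, Wb, Wd]; simp; linarith
  have dcd : dist (W c) (W d) = 1 := by
    rw [← sq_eq_sq₀ dist_nonneg zero_le_one, dist_sq_plane, Wc, Wd]; simp; linarith
  refine ⟨W, ?_, ?_, ?_, ?_⟩
  · intro i j hi hj hij
    rcases eq_of_nodup h i with rfl | rfl | rfl | rfl <;>
      rcases eq_of_nodup h j with rfl | rfl | rfl | rfl <;>
      first | exact absurd rfl hi | exact absurd rfl hj | exact absurd rfl hij | assumption |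
        (rw [dist_comm]; assumption)
  · rcases hη' with ⟨h1, h2⟩ | ⟨h1, h2⟩
    · refine isOriented_of_ccw h1 ?_
      rw [Wb, Wc, Wd, area]; simpa using h2
    · refine isOriented_of_ccw h1 ?_
      rw [Wb, Wc, Wd, area]; simpa using h2
  · refine ⟨LinearMap.mk ⟨fun z => z 0 - z 1 / (2 * η), ?_⟩ ?_, ?_, ?_, ?_⟩
    · intro x y; simp; ring
    · intro r x; simp; ring
    · simp [Wb]
    · simp [Wc]
    · simp [Wd]; field_simp; ring
  · refine ⟨LinearMap.mk ⟨fun z => z 1 / η, ?_⟩ ?_, ?_, ?_, ?_⟩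
    · intro x y; simp; ring
    · intro r x; simp; ring
    · simp [Wb]
    · simp [Wc]
    · simp [Wd, hη0]

theorem stripFrame_apply {A : Type*} [AddCommGroup A] (W : Fin 4 → A) {a b c d : Fin 4}
    (h : [a, b, c, d].Nodup) : stripFrame W a b c d a = W ∧ stripFrame W a b c d b = roll W a b ∧
      stripFrame W a b c d c = roll (roll W a b) b c ∧
      stripFrame W a b c d d = roll (roll (roll W a b) b c) c d := by
  have hd := h
  simp only [List.nodup_cons, List.mem_cons, List.not_mem_nil, or_false, not_or] at hd
  obtain ⟨⟨ab, ac, ad⟩, ⟨bc, bd⟩, cd, -⟩ := hd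
  simp [stripFrame, Ne.symm ab, Ne.symm ac, Ne.symm bc, Ne.symm ad, Ne.symm bd, Ne.symm cd]

/-- The lines through the three glued edges do the separation: `s = 0` cuts off the first triangle,
`t = 1` the first two from the last two, and `s = -1` the last one from the third. -/
theorem disjoint_interior_stripFrame {a b c d : Fin 4} (h : [a, b, c, d].Nodup)
    {H : Type*} [NormedAddCommGroup H] [InnerProductSpace ℝ H] {W : Fin 4 → H}
    (hs : ∃ s : H →ₗ[ℝ] ℝ, s (W b) = 1 ∧ s (W c) = 0 ∧ s (W d) = 0)
    (ht : ∃ t : H →ₗ[ℝ] ℝ, t (W b) = 0 ∧ t (W c) = 0 ∧ t (W d) = 1)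
    {m n : Fin 4} (hmn : m ≠ n) (hm : m = a ∨ m = b ∧ n ≠ a ∨ m = c ∧ n = d) :
    Disjoint (interior (P.lift (stripFrame W a b c d m) '' P.face m))
      (interior (P.lift (stripFrame W a b c d n) '' P.face n)) := by
  obtain ⟨s, sb, sc, sd⟩ := hs
  obtain ⟨t, tb, tc, td⟩ := ht
  have s0 : s (W b) ≠ 0 := by rw [sb]; exact one_ne_zero
  have t0 : t (W d) ≠ 0 := by rw [td]; exact one_ne_zero
  obtain ⟨pa, pb, pc, pd⟩ := stripFrame_apply W h
  obtain ⟨q1, q2, q3⟩ := roll_roll_apply W h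
  obtain ⟨r1, r2, r3⟩ := roll_roll_roll_apply W h
  have q0 : roll W a b a = W c + W d - W b := roll_apply_self W h
  have hd := h
  simp only [List.nodup_cons, List.mem_cons, List.not_mem_nil, or_false, not_or] at hd
  have u1 : roll W a b c = W c := roll_apply_of_ne W (by tauto)
  have u2 : roll W a b d = W d := roll_apply_of_ne W (by tauto)
  have cases4 : ∀ {k : Fin 4} {p : Fin 4 → Prop}, (a ≠ k → p a) → (b ≠ k → p b) →
      (c ≠ k → p c) → (d ≠ k → p d) → ∀ i, i ≠ k → p i := by
    intro k p ha hb hc hd i hi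
    rcases eq_of_nodup h i with rfl | rfl | rfl | rfl
    exacts [ha hi, hb hi, hc hi, hd hi]
  rcases hm with rfl | ⟨rfl, hn⟩ | ⟨rfl, rfl⟩
  · refine (disjoint_interior_lift s s0 (k := 0) ?_ ?_).symm
    · rcases eq_of_nodup h n with rfl | rfl | rfl | rfl
      · exact absurd rfl hmn
      · rw [pb]; refine cases4 ?_ ?_ ?_ ?_ <;> intro hk <;>
          first | exact absurd rfl hk | (simp only [q0, u1, u2, map_add, map_sub, sb, sc, sd]; norm_num)
      · rw [pc]; refine cases4 ?_ ?_ ?_ ?_ <;> intro hk <;>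
          first | exact absurd rfl hk | (simp only [q1, q2, q3, map_add, map_sub, sb, sc, sd]; norm_num)
      · rw [pd]; refine cases4 ?_ ?_ ?_ ?_ <;> intro hk <;>
          first | exact absurd rfl hk | (simp only [r1, r2, r3, map_add, map_sub, sb, sc, sd]; norm_num)
    · rw [pa]; refine cases4 ?_ ?_ ?_ ?_ <;> intro hk <;>
        first | exact absurd rfl hk | (simp only [sb, sc, sd]; norm_num)
  · refine disjoint_interior_lift t t0 (k := 1) ?_ ?_
    · rw [pb]; refine cases4 ?_ ?_ ?_ ?_ <;> intro hk <;>
        first | exact absurd rfl hk | (simp only [q0, u1, u2, map_add, map_sub, tb, tc, td]; norm_num)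
    · rcases eq_of_nodup h n with rfl | rfl | rfl | rfl
      · exact absurd rfl hn
      · exact absurd rfl hmn
      · rw [pc]; refine cases4 ?_ ?_ ?_ ?_ <;> intro hk <;>
          first | exact absurd rfl hk | (simp only [q1, q2, q3, map_add, map_sub, tb, tc, td]; norm_num)
      · rw [pd]; refine cases4 ?_ ?_ ?_ ?_ <;> intro hk <;>
          first | exact absurd rfl hk | (simp only [r1, r2, r3, map_add, map_sub, tb, tc, td]; norm_num)
  · refine (disjoint_interior_lift s s0 (k := -1) ?_ ?_).symm
    · rw [pd]; refine cases4 ?_ ?_ ?_ ?_ <;> intro hk <;>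
        first | exact absurd rfl hk | (simp only [r1, r2, r3, map_add, map_sub, sb, sc, sd]; norm_num)
    · rw [pc]; refine cases4 ?_ ?_ ?_ ?_ <;> intro hk <;>
        first | exact absurd rfl hk | (simp only [q1, q2, q3, map_add, map_sub, sb, sc, sd]; norm_num)

/-- Every order of the four faces is realised. Landscapes of two or three faces are then read off as
initial pieces of the same strip. -/
theorem exists_strip {a b c d : Fin 4} (h : [a, b, c, d].Nodup) :
    ∃ N : P.Net, N.HasLandscape [a, b, c, d] := by
  obtain ⟨W, hW, ho, hs, ht⟩ := exists_oriented_frame (P := P) h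
  obtain ⟨pa, pb, pc, pd⟩ := stripFrame_apply W h
  have hd := h
  simp only [List.nodup_cons, List.mem_cons, List.not_mem_nil, or_false, not_or] at hd
  obtain ⟨⟨ab, ac, ad⟩, ⟨bc, bd⟩, cd, -⟩ := hd
  have adj1 : (P.dualGraph fun n => P.lift (stripFrame W a b c d n)).Adj a b :=
    ⟨ab, fun x hx => by simp only [pa, pb, lift_roll b hx.1]⟩
  have adj2 : (P.dualGraph fun n => P.lift (stripFrame W a b c d n)).Adj b c :=
    ⟨bc, fun x hx => by simp only [pb, pc, lift_roll c hx.1]⟩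
  have adj3 : (P.dualGraph fun n => P.lift (stripFrame W a b c d n)).Adj c d :=
    ⟨cd, fun x hx => by simp only [pc, pd, lift_roll d hx.1]⟩
  refine ⟨⟨fun n => P.lift (stripFrame W a b c d n), ?_, ?_, ?_, ?_⟩, ?_, h, ?_⟩
  · intro n x hx y hy
    refine dist_lift ?_ hx hy
    rcases eq_of_nodup h n with rfl | rfl | rfl | rfl
    · rw [pa]; exact hW
    · rw [pb]; exact hW.roll ab
    · rw [pc]; exact (hW.roll ab).roll bc
    · rw [pd]; exact ((hW.roll ab).roll bc).roll cd
  · intro n u v w hc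
    simp only [lift_vertex]
    revert u v w
    change P.IsOriented n _
    rcases eq_of_nodup h n with rfl | rfl | rfl | rfl
    · rw [pa]; exact ho
    · rw [pb]; exact ho.roll ab
    · rw [pc]; exact (ho.roll ab).roll bc
    · rw [pd]; exact ((ho.roll ab).roll bc).roll cd
  · intro m n hmn
    have : (m = a ∨ m = b ∧ n ≠ a ∨ m = c ∧ n = d) ∨ (n = a ∨ n = b ∧ m ≠ a ∨ n = c ∧ m = d) := by
      clear * - h hmn; revert a b c d m n; decide
    rcases this with h1 | h1
    · exact disjoint_interior_stripFrame h hs ht hmn h1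
    · exact (disjoint_interior_stripFrame h hs ht hmn.symm h1).symm
  · refine SimpleGraph.Connected.mk (fun m n => ?_)
    have : ∀ k, (P.dualGraph fun n => P.lift (stripFrame W a b c d n)).Reachable a k := by
      intro k
      rcases eq_of_nodup h k with rfl | rfl | rfl | rfl
      · exact SimpleGraph.Reachable.refl _
      · exact adj1.reachable
      · exact adj1.reachable.trans adj2.reachable
      · exact (adj1.reachable.trans adj2.reachable).trans adj3.reachable
    exact (this m).symm.trans (this n)
  · simp
  · simp only [List.isChain_cons_cons, List.isChain_singleton, and_true]
    exact ⟨adj1, adj2, adj3⟩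

end Strip

end UnitTetrahedron

end

noncomputable section

open Finset

/-! ### Lengths of paths and lifting along a path. -/

section Paths

theorem segment_subset_segment_union {E : Type*} [AddCommGroup E] [Module ℝ E] {x y z : E}
    (h : y ∈ segment ℝ x z) : segment ℝ x z ⊆ segment ℝ x y ∪ segment ℝ y z := by
  intro w hw
  rw [segment_eq_image'] at h hw
  obtain ⟨r, ⟨hr0, hr1⟩, rfl⟩ := h
  obtain ⟨s, ⟨hs0, hs1⟩, rfl⟩ := hw
  rcases le_total s r with hsr | hsr
  · left
    rcases hr0.eq_or_lt with rfl | hr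
    · obtain rfl : s = 0 := le_antisymm hsr hs0
      simp
    · rw [segment_eq_image']
      refine ⟨s / r, ⟨by positivity, (div_le_one hr).2 hsr⟩, ?_⟩
      simp only [add_sub_cancel_left, smul_smul]
      rw [div_mul_cancel₀ _ hr.ne']
  · right
    rcases hr1.eq_or_lt with rfl | hr
    · obtain rfl : s = 1 := le_antisymm hs1 hsr
      simp
    · have hr' : 0 < 1 - r := by linarith
      rw [segment_eq_image']
      refine ⟨(s - r) / (1 - r), ⟨div_nonneg (by linarith) hr'.le,
        (div_le_one hr').2 (by linarith)⟩, ?_⟩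
      have : z - (x + r • (z - x)) = (1 - r) • (z - x) := by module
      simp only [this, smul_smul]
      rw [div_mul_cancel₀ _ hr'.ne']
      module

/-- The points near a path can be lifted along it if they can be lifted within each of finitely
many closed sets covering it. -/
theorem exists_lift_along {ι E Z : Type*} [PseudoEMetricSpace E] [PseudoEMetricSpace Z]
    [DecidableEq ι] {F : ι → Set E} (hF : ∀ i, IsClosed (F i)) {R : E → Z → Prop}
    (hR : ∀ i, ∀ x ∈ F i, ∀ y ∈ F i, ∀ z, R x z → ∃ z', R y z' ∧ edist z z' ≤ edist x y)
    {γ : unitInterval → E} (hγ : Continuous γ) (s : Finset ι) (t : unitInterval) (z : Z)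
    (hs : ∀ τ, t ≤ τ → ∃ i ∈ s, γ τ ∈ F i) (hz : R (γ t) z) :
    ∃ z', R (γ 1) z' ∧ edist z z' ≤ eVariationOn γ (Set.univ ∩ Set.Icc t 1) := by
  induction s using Finset.strongInduction generalizing t z with
  | H s ih =>
    obtain ⟨i, his, hti⟩ := hs t le_rfl
    have hK : IsCompact {τ | t ≤ τ ∧ γ τ ∈ F i} :=
      (isClosed_Ici.inter ((hF i).preimage hγ)).isCompact
    -- Jumping to the last time in `F i` discards `F i` for good. The induction runs over the
    -- remaining sets, so infinitely many crossings do no harm.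
    obtain ⟨τ, ⟨htτ, hτ⟩, hmax⟩ := hK.exists_isGreatest ⟨t, le_rfl, hti⟩
    obtain ⟨z₁, hz₁, hd₁⟩ := hR i _ hti _ hτ z hz
    have h1 : edist (γ t) (γ τ) ≤ eVariationOn γ (Set.univ ∩ Set.Icc t τ) :=
      eVariationOn.edist_le γ ⟨trivial, le_rfl, htτ⟩ ⟨trivial, htτ, le_rfl⟩
    rcases (unitInterval.le_one' : τ ≤ 1).eq_or_lt with rfl | hτ1
    · exact ⟨z₁, hz₁, hd₁.trans h1⟩
    have hgt : ∀ σ, τ < σ → ∃ j ∈ s.erase i, γ σ ∈ F j := by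
      intro σ hσ
      obtain ⟨j, hj, hσj⟩ := hs σ (htτ.trans hσ.le)
      refine ⟨j, mem_erase.2 ⟨?_, hj⟩, hσj⟩
      rintro rfl
      exact absurd (hmax ⟨htτ.trans hσ.le, hσj⟩) (not_le.2 hσ)
    -- At the time `τ` itself another set is needed too; it comes from closedness of the finite
    -- union.
    have hge : ∀ σ, τ ≤ σ → ∃ j ∈ s.erase i, γ σ ∈ F j := by
      intro σ hσ
      rcases hσ.eq_or_lt with rfl | hσ
      · have hcl : IsClosed (γ ⁻¹' ⋃ j ∈ s.erase i, F j) :=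
          ((s.erase i).finite_toSet.isClosed_biUnion fun j _ => hF j).preimage hγ
        have hsub : Set.Ioi τ ⊆ γ ⁻¹' ⋃ j ∈ s.erase i, F j := fun σ hσ => by
          simpa using hgt σ hσ
        have : τ ∈ closure (Set.Ioi τ) := by
          rw [closure_Ioi' (⟨1, hτ1⟩ : (Set.Ioi τ).Nonempty)]; exact Set.self_mem_Ici
        simpa using closure_minimal hsub hcl this
      · exact hgt σ hσ
    obtain ⟨z₂, hz₂, hd₂⟩ := ih _ (erase_ssubset his) τ z₁ hge hz₁
    refine ⟨z₂, hz₂, ?_⟩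
    rw [← eVariationOn.Icc_add_Icc γ htτ hτ1.le (Set.mem_univ _)]
    exact (edist_triangle _ _ _).trans (add_le_add (hd₁.trans h1) hd₂)

theorem eVariationOn_trans_le {E : Type*} [PseudoEMetricSpace E] {x y z : E} (γ : Path x y)
    (γ' : Path y z) : eVariationOn (γ.trans γ') Set.univ ≤
      eVariationOn γ Set.univ + eVariationOn γ' Set.univ := by
  let h : unitInterval := ⟨1 / 2, by norm_num, by norm_num⟩
  have hu : (Set.univ : Set unitInterval) = Set.Iic h ∪ Set.Ici h := Set.Iic_union_Ici.symm
  have hm : ∀ c : ℝ, Monotone fun t : unitInterval =>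
      Set.projIcc (0 : ℝ) 1 zero_le_one (2 * (t : ℝ) - c) := fun c s t hst =>
    Set.monotone_projIcc _ (by have : (s : ℝ) ≤ t := hst; linarith)
  conv_lhs => rw [hu, eVariationOn.union _ isGreatest_Iic isLeast_Ici]
  refine add_le_add ?_ ?_
  · rw [eVariationOn.eq_of_eqOn (f' := γ ∘ fun t : unitInterval =>
      Set.projIcc (0 : ℝ) 1 zero_le_one (2 * (t : ℝ) - 0))]
    · exact eVariationOn.comp_le_of_monotoneOn _ _ ((hm 0).monotoneOn _) fun _ _ => trivial
    · intro t ht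
      have ht' : (t : ℝ) ≤ 1 / 2 := ht
      rw [Path.trans_apply, dif_pos ht', Function.comp]
      congr 1
      rw [Set.projIcc_of_mem _ (⟨by linarith [t.2.1], by linarith⟩ : 2 * (t : ℝ) - 0 ∈ Set.Icc (0 : ℝ) 1)]
      ext; simp
  · rw [eVariationOn.eq_of_eqOn (f' := γ' ∘ fun t : unitInterval =>
      Set.projIcc (0 : ℝ) 1 zero_le_one (2 * (t : ℝ) - 1))]
    · exact eVariationOn.comp_le_of_monotoneOn _ _ ((hm 1).monotoneOn _) fun _ _ => trivial
    · intro t ht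
      have ht' : 1 / 2 ≤ (t : ℝ) := ht
      have hmem : 2 * (t : ℝ) - 1 ∈ Set.Icc (0 : ℝ) 1 := ⟨by linarith, by linarith [t.2.2]⟩
      simp only [Function.comp]
      rw [Set.projIcc_of_mem _ hmem, Path.trans_apply]
      split_ifs with h2
      · have h3 : (t : ℝ) = 1 / 2 := le_antisymm h2 ht'
        have e1 : (⟨2 * (t : ℝ), by rw [h3]; norm_num⟩ : unitInterval) = 1 := by
          ext; simp [h3]
        have e2 : (⟨2 * (t : ℝ) - 1, hmem⟩ : unitInterval) = 0 := by
          ext; simp [h3]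
        rw [e2, γ'.source]
        exact (congrArg γ e1).trans γ.target
      · rfl

end Paths

namespace UnitTetrahedron

variable {P : UnitTetrahedron}

theorem surfaceDist_triangle (p q r : EuclideanSpace ℝ (Fin 3)) :
    P.surfaceDist p r ≤ P.surfaceDist p q + P.surfaceDist q r := by
  refine ENNReal.le_iInf₂_add_iInf₂ fun γ h γ' h' => ?_
  refine (iInf₂_le (γ.trans γ') ?_).trans (eVariationOn_trans_le γ γ')
  intro t
  rw [Path.trans_apply]
  split_ifs
  · exact h _
  · exact h' _

theorem face_subset_surface (n : Fin 4) : P.face n ⊆ P.surface := Set.subset_iUnion _ n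

theorem convex_face (n : Fin 4) : Convex ℝ (P.face n) := convex_convexHull ℝ _

theorem isClosed_face (n : Fin 4) : IsClosed (P.face n) :=
  ((Set.toFinite _).isCompact_convexHull (𝕜 := ℝ)).isClosed

theorem surfaceDist_le_edist {n : Fin 4} {p q : EuclideanSpace ℝ (Fin 3)} (hp : p ∈ P.face n)
    (hq : q ∈ P.face n) : P.surfaceDist p q ≤ edist p q := by
  let γ : Path p q :=
    { toFun := fun t => AffineMap.lineMap p q (t : ℝ)
      continuous_toFun := by fun_prop
      source' := by simp
      target' := by simp }
  refine (iInf₂_le γ fun t => face_subset_surface n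
    ((convex_face n).lineMap_mem hp hq t.2)).trans ?_
  have h1 : eVariationOn (fun t : unitInterval => (t : ℝ)) Set.univ ≤ 1 := by
    have := MonotoneOn.eVariationOn_eq (f := fun t : unitInterval => (t : ℝ)) (s := Set.univ)
      (a := 0) (b := 1) (fun s _ t _ h => h) trivial trivial
    have h2 : (Set.univ ∩ Set.Icc 0 1 : Set unitInterval) = Set.univ := by
      ext t; simp [unitInterval.le_one']
    rw [h2] at this
    rw [this]; simp
  have h2 := ((lipschitzWith_lineMap (𝕜 := ℝ) p q).lipschitzOnWith
    (s := Set.univ)).comp_eVariationOn_le (g := fun t : unitInterval => (t : ℝ)) (s := Set.univ)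
    (fun _ _ => trivial)
  calc eVariationOn γ Set.univ ≤ nndist p q * 1 := h2.trans (by gcongr)
    _ = edist p q := by rw [mul_one, edist_nndist]

end UnitTetrahedron

end

noncomputable section

open Finset

namespace UnitTetrahedron

variable {P : UnitTetrahedron} {H : Type*} [NormedAddCommGroup H] [InnerProductSpace ℝ H]
  {a b c d : Fin 4}

/-! ### Straight segments stay inside a strip. -/

section Crossing

/-- One surface point must work for all `W` at once, because a crossing point is seen in the frames
of both adjacent faces. -/
theorem exists_edge_point {i j : Fin 4} {r s : ℝ} (hr : 0 ≤ r) (hs : 0 ≤ s) (hrs : r + s = 1) :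
    ∃ x, (∀ n, n ≠ i → n ≠ j → x ∈ P.face n) ∧ ∀ W : Fin 4 → H, P.lift W x = r • W i + s • W j := by
  have h1 : ∑ k, (Pi.single i r + Pi.single j s : Fin 4 → ℝ) k = 1 := by
    simp [sum_add_distrib, hrs]
  refine ⟨∑ k, (Pi.single i r + Pi.single j s : Fin 4 → ℝ) k • P.V k, fun n hi hj => ?_, fun W => ?_⟩
  · refine sum_smul_mem_face (fun k => ?_) ?_ h1
    · simp only [Pi.add_apply, Pi.single_apply]
      split_ifs <;> linarith
    · simp [hi, hj]
  · rw [lift, P.bary_sum_smul h1]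
    simp [add_smul, sum_add_distrib, Pi.single_apply]

theorem exists_convex_combination_eq {p q k : ℝ} (hp : k ≤ p) (hq : q ≤ k) :
    ∃ s t : ℝ, 0 ≤ s ∧ 0 ≤ t ∧ s + t = 1 ∧ s * p + t * q = k := by
  rcases eq_or_lt_of_le (hq.trans hp) with h | h
  · exact ⟨1, 0, zero_le_one, le_rfl, by ring, by linarith⟩
  · have h0 : p - q ≠ 0 := by linarith
    exact ⟨(k - q) / (p - q), (p - k) / (p - q), div_nonneg (by linarith) (by linarith),
      div_nonneg (by linarith) (by linarith), by field_simp; ring, by field_simp; ring⟩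

theorem lift_eq (h : [a, b, c, d].Nodup) (W : Fin 4 → H) {x : EuclideanSpace ℝ (Fin 3)}
    (hx : x ∈ P.face a) :
    P.lift W x = P.bary x b • W b + P.bary x c • W c + P.bary x d • W d := by
  rw [lift, sum_four h, bary_self hx, zero_smul, zero_add]

theorem sum_bary_eq (h : [a, b, c, d].Nodup) {x : EuclideanSpace ℝ (Fin 3)}
    (hx : x ∈ P.face a) : P.bary x b + P.bary x c + P.bary x d = 1 := by
  rw [← sum_bary hx, sum_four h, bary_self hx, zero_add]

theorem segment_lift_subset {n : Fin 4} (W : Fin 4 → H) {x y : EuclideanSpace ℝ (Fin 3)}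
    (hx : x ∈ P.face n) (hy : y ∈ P.face n) :
    segment ℝ (P.lift W x) (P.lift W y) ⊆ P.lift W '' P.face n := by
  rintro _ ⟨s, t, hs, ht, hst, rfl⟩
  refine ⟨s • x + t • y, convex_face n hx hy hs ht hst, ?_⟩
  have h1 : s • x + t • y = ∑ i, (s * P.bary x i + t * P.bary y i) • P.V i := by
    conv_lhs => rw [← sum_bary_smul hx, ← sum_bary_smul hy]
    simp [add_smul, sum_add_distrib, smul_sum, mul_smul]
  rw [h1, lift, P.bary_sum_smul (by
    rw [sum_add_distrib, ← mul_sum, ← mul_sum, sum_bary hx, sum_bary hy, mul_one, mul_one, hst])]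
  simp [lift, add_smul, sum_add_distrib, smul_sum, mul_smul]

/-- Peels one face off a trail at the crossing point `x`: lengths add along a segment, and `S` is
the region of the remaining faces. -/
theorem trail_cons {n : Fin 4} {W : Fin 4 → H} (hW : IsFrame n W)
    {p x q : EuclideanSpace ℝ (Fin 3)} (hp : p ∈ P.face n) (hx : x ∈ P.face n) {Q : H} {S : Set H}
    (hxQ : P.lift W x ∈ segment ℝ (P.lift W p) Q)
    (h : P.surfaceDist x q ≤ edist (P.lift W x) Q ∧ segment ℝ (P.lift W x) Q ⊆ S) :
    P.surfaceDist p q ≤ edist (P.lift W p) Q ∧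
      segment ℝ (P.lift W p) Q ⊆ P.lift W '' P.face n ∪ S := by
  constructor
  · refine (surfaceDist_triangle p x q).trans ?_
    rw [edist_dist _ Q, ← dist_add_dist_of_mem_segment hxQ, ENNReal.ofReal_add dist_nonneg
      dist_nonneg, ← edist_dist, ← edist_dist]
    refine add_le_add ((surfaceDist_le_edist hp hx).trans_eq ?_) h.1
    rw [edist_dist, edist_dist, dist_lift hW hp hx]
  · exact (segment_subset_segment_union hxQ).trans
      (Set.union_subset_union (segment_lift_subset W hp hx) h.2)

theorem trail_nil {n : Fin 4} {W : Fin 4 → H} (hW : IsFrame n W)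
    {p q : EuclideanSpace ℝ (Fin 3)} (hp : p ∈ P.face n) (hq : q ∈ P.face n) :
    P.surfaceDist p q ≤ edist (P.lift W p) (P.lift W q) ∧
      segment ℝ (P.lift W p) (P.lift W q) ⊆ P.lift W '' P.face n := by
  refine ⟨(surfaceDist_le_edist hp hq).trans_eq ?_, segment_lift_subset W hp hq⟩
  rw [edist_dist, edist_dist, dist_lift hW hp hq]

variable {W : Fin 4 → H} {p q : EuclideanSpace ℝ (Fin 3)}

/-- Writing each copy in the frame of the first face turns the crossing conditions into inequalities
between coefficients. -/
theorem lift_roll_eq (h : [a, b, c, d].Nodup) (W : Fin 4 → H) (hq : q ∈ P.face b) :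
    P.lift (roll W a b) q = (-P.bary q a) • W b + (P.bary q c + P.bary q a) • W c +
      (P.bary q d + P.bary q a) • W d := by
  have h' : [b, a, c, d].Nodup := by clear * - h; revert a b c d; decide
  have e := roll_apply_self W h
  rw [lift_eq h' _ hq, e]
  simp only [List.nodup_cons, List.mem_cons, List.not_mem_nil, or_false, not_or] at h
  rw [roll_apply_of_ne W (i := c) (by tauto), roll_apply_of_ne W (i := d) (by tauto)]
  module

theorem lift_roll_roll_eq (h : [a, b, c, d].Nodup) (W : Fin 4 → H) (hq : q ∈ P.face c) :
    P.lift (roll (roll W a b) b c) q = (-(P.bary q a + P.bary q b)) • W b + P.bary q a • W c +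
      (P.bary q a + 2 * P.bary q b + P.bary q d) • W d := by
  have h' : [c, a, b, d].Nodup := by clear * - h; revert a b c d; decide
  obtain ⟨h1, h2, h3⟩ := roll_roll_apply W h
  rw [lift_eq h' _ hq, h1, h2, h3]
  module

theorem lift_roll_roll_roll_eq (h : [a, b, c, d].Nodup) (W : Fin 4 → H) (hq : q ∈ P.face d) :
    P.lift (roll (roll (roll W a b) b c) c d) q =
      (-(P.bary q a + P.bary q b + 2 * P.bary q c)) • W b + (P.bary q a + P.bary q c) • W c +
        (P.bary q a + 2 * P.bary q b + 2 * P.bary q c) • W d := by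
  have h' : [d, a, b, c].Nodup := by clear * - h; revert a b c d; decide
  obtain ⟨h1, h2, h3⟩ := roll_roll_roll_apply W h
  rw [lift_eq h' _ hq, h1, h2, h3]
  module

/-- A segment that starts in the first triangle of a strip and leaves it across the edge to the
second one. -/
theorem exists_cross_first (h : [a, b, c, d].Nodup) (W : Fin 4 → H) (hp : p ∈ P.face a)
    {r s t : ℝ} (hr : r ≤ 0) (hs : 0 ≤ s) (hs1 : s ≤ 1) (hrst : r + s + t = 1) :
    ∃ x ∈ P.face a ∩ P.face b, ∃ k : ℝ, 0 ≤ k ∧ k ≤ 1 ∧ P.lift W x = k • W c + (1 - k) • W d ∧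
      P.lift W x ∈ segment ℝ (P.lift W p) (r • W b + s • W c + t • W d) := by
  have hb := bary_nonneg hp b
  have hc := bary_nonneg hp c
  have hd := bary_nonneg hp d
  have hsum := sum_bary_eq h hp
  -- The first glued edge lies where the coefficient of `W b` vanishes. On the whole strip the
  -- coefficient of `W c` is between `0` and `1`, which puts the crossing point on the edge itself.
  obtain ⟨σ, τ, hσ, hτ, hστ, hk⟩ := exists_convex_combination_eq hb hr
  have k0 : 0 ≤ σ * P.bary p c + τ * s := by positivity
  have k1 : 0 ≤ 1 - (σ * P.bary p c + τ * s) := by nlinarith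
  obtain ⟨x, hx, hl⟩ := exists_edge_point (P := P) (H := H) (i := c) (j := d) k0 k1 (by ring)
  have h' := h
  simp only [List.nodup_cons, List.mem_cons, List.not_mem_nil, or_false, not_or] at h'
  refine ⟨x, ⟨hx a (by tauto) (by tauto), hx b (by tauto) (by tauto)⟩, _, k0, by linarith, hl W, ?_⟩
  refine ⟨σ, τ, hσ, hτ, hστ, ?_⟩
  rw [hl, lift_eq h W hp]
  have e1 : P.bary p d = 1 - P.bary p b - P.bary p c := by linarith
  have e2 : t = 1 - r - s := by linarith
  have e3 : σ = 1 - τ := by linarith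
  subst e2 e3
  rw [e1]
  linear_combination (norm := module) hk • W b - hk • W d

/-- A segment in a strip that crosses from the second triangle to the third one. -/
theorem exists_cross_second (h : [a, b, c, d].Nodup) (W : Fin 4 → H) {k : ℝ} (hk : 0 ≤ k)
    (hk1 : k ≤ 1) {r s t : ℝ} (hs : 0 ≤ s) (hs1 : s ≤ 1) (ht : 1 ≤ t) (hrst : r + s + t = 1) :
    ∃ y ∈ P.face b ∩ P.face c, ∃ l : ℝ, 0 ≤ l ∧ l ≤ 1 ∧
      P.lift (roll W a b) y = (-l) • W b + l • W c + W d ∧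
      P.lift (roll W a b) y ∈
        segment ℝ (k • W c + (1 - k) • W d) (r • W b + s • W c + t • W d) := by
  -- The second glued edge lies where the coefficient of `W d` equals `1`.
  obtain ⟨τ, σ, hτ, hσ, hστ, hl⟩ := exists_convex_combination_eq ht (by linarith : 1 - k ≤ 1)
  have k0 : 0 ≤ σ * k + τ * s := by positivity
  have k1 : 0 ≤ 1 - (σ * k + τ * s) := by nlinarith
  obtain ⟨x, hx, hlift⟩ := exists_edge_point (P := P) (H := H) (i := a) (j := d) k0 k1 (by ring)
  have e := roll_apply_self W h
  simp only [List.nodup_cons, List.mem_cons, List.not_mem_nil, or_false, not_or] at h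
  have hval : P.lift (roll W a b) x =
      (-(σ * k + τ * s)) • W b + (σ * k + τ * s) • W c + W d := by
    rw [hlift, e, roll_apply_of_ne W (i := d) (by tauto)]
    module
  refine ⟨x, ⟨hx b (by tauto) (by tauto), hx c (by tauto) (by tauto)⟩, _, k0, by linarith, hval,
    σ, τ, hσ, hτ, by linarith, ?_⟩
  rw [hval]
  have e1 : r = 1 - s - t := by linarith
  have e2 : σ = 1 - τ := by linarith
  subst e1 e2
  linear_combination (norm := module) hl • W d - hl • W b

/-- A segment in a strip that crosses from the third triangle to the fourth one. -/
theorem exists_cross_third (h : [a, b, c, d].Nodup) (W : Fin 4 → H) {k : ℝ} (hk : 0 ≤ k)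
    (hk1 : k ≤ 1) {r s t : ℝ} (hs : 0 ≤ s) (hs1 : s ≤ 1) (hr : r ≤ -1) (hrst : r + s + t = 1) :
    ∃ z ∈ P.face c ∩ P.face d, P.lift (roll (roll W a b) b c) z ∈
        segment ℝ ((-k) • W b + k • W c + W d) (r • W b + s • W c + t • W d) := by
  -- The third glued edge lies where the coefficient of `W b` equals `-1`.
  obtain ⟨σ, τ, hσ, hτ, hστ, hl⟩ := exists_convex_combination_eq (by linarith : -1 ≤ -k) hr
  have k0 : 0 ≤ σ * k + τ * s := by positivity
  have k1 : 0 ≤ 1 - (σ * k + τ * s) := by nlinarith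
  obtain ⟨x, hx, hlift⟩ := exists_edge_point (P := P) (H := H) (i := a) (j := b) k0 k1 (by ring)
  obtain ⟨h1, h2, -⟩ := roll_roll_apply W h
  simp only [List.nodup_cons, List.mem_cons, List.not_mem_nil, or_false, not_or] at h
  refine ⟨x, ⟨hx c (by tauto) (by tauto), hx d (by tauto) (by tauto)⟩, σ, τ, hσ, hτ, hστ, ?_⟩
  rw [hlift, h1, h2]
  have e1 : t = 1 - r - s := by linarith
  have e2 : σ = 1 - τ := by linarith
  subst e1 e2
  linear_combination (norm := module) hl • W b - hl • W d

theorem trail_two (h : [a, b, c, d].Nodup) (hW : IsFrame a W) (hp : p ∈ P.face a)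
    (hq : q ∈ P.face b) :
    P.surfaceDist p q ≤ edist (P.lift W p) (P.lift (roll W a b) q) ∧
      segment ℝ (P.lift W p) (P.lift (roll W a b) q) ⊆
        P.lift W '' P.face a ∪ P.lift (roll W a b) '' P.face b := by
  have ab : a ≠ b := by clear * - h; revert a b c d; decide
  have h' : [b, a, c, d].Nodup := by clear * - h; revert a b c d; decide
  have ha := bary_nonneg hq a
  have hc := bary_nonneg hq c
  have hd := bary_nonneg hq d
  have hs := sum_bary_eq h' hq
  obtain ⟨x, ⟨hxa, hxb⟩, -, -, -, -, hx⟩ := exists_cross_first h W hp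
    (r := -P.bary q a) (s := P.bary q c + P.bary q a) (t := P.bary q d + P.bary q a)
    (by linarith) (by linarith) (by linarith) (by linarith)
  rw [← lift_roll_eq h W hq] at hx
  refine trail_cons hW hp hxa hx ?_
  rw [← lift_roll b hxa]
  exact trail_nil (hW.roll ab) hxb hq

theorem trail_three (h : [a, b, c, d].Nodup) (hW : IsFrame a W) (hp : p ∈ P.face a)
    (hq : q ∈ P.face c) :
    P.surfaceDist p q ≤ edist (P.lift W p) (P.lift (roll (roll W a b) b c) q) ∧
      segment ℝ (P.lift W p) (P.lift (roll (roll W a b) b c) q) ⊆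
        P.lift W '' P.face a ∪ (P.lift (roll W a b) '' P.face b ∪
          P.lift (roll (roll W a b) b c) '' P.face c) := by
  have ab : a ≠ b := by clear * - h; revert a b c d; decide
  have bc : b ≠ c := by clear * - h; revert a b c d; decide
  have h' : [c, a, b, d].Nodup := by clear * - h; revert a b c d; decide
  have ha := bary_nonneg hq a
  have hb := bary_nonneg hq b
  have hd := bary_nonneg hq d
  have hs := sum_bary_eq h' hq
  obtain ⟨x, ⟨hxa, hxb⟩, k, hk0, hk1, hxk, hx⟩ := exists_cross_first h W hp
    (r := -(P.bary q a + P.bary q b)) (s := P.bary q a)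
    (t := P.bary q a + 2 * P.bary q b + P.bary q d)
    (by linarith) (by linarith) (by linarith) (by linarith)
  obtain ⟨y, ⟨hyb, hyc⟩, -, -, -, -, hy⟩ := exists_cross_second (P := P) h W hk0 hk1
    (r := -(P.bary q a + P.bary q b)) (s := P.bary q a)
    (t := P.bary q a + 2 * P.bary q b + P.bary q d)
    (by linarith) (by linarith) (by linarith) (by linarith)
  rw [← lift_roll_roll_eq h W hq] at hx hy
  rw [← hxk] at hy
  refine trail_cons hW hp hxa hx ?_
  rw [← lift_roll b hxa] at hy ⊢
  refine trail_cons (hW.roll ab) hxb hyb hy ?_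
  rw [← lift_roll c hyb]
  exact trail_nil ((hW.roll ab).roll bc) hyc hq

theorem trail_four (h : [a, b, c, d].Nodup) (hW : IsFrame a W) (hp : p ∈ P.face a)
    (hq : q ∈ P.face d) :
    P.surfaceDist p q ≤ edist (P.lift W p) (P.lift (roll (roll (roll W a b) b c) c d) q) ∧
      segment ℝ (P.lift W p) (P.lift (roll (roll (roll W a b) b c) c d) q) ⊆
        P.lift W '' P.face a ∪ (P.lift (roll W a b) '' P.face b ∪
          (P.lift (roll (roll W a b) b c) '' P.face c ∪
            P.lift (roll (roll (roll W a b) b c) c d) '' P.face d)) := by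
  have ab : a ≠ b := by clear * - h; revert a b c d; decide
  have bc : b ≠ c := by clear * - h; revert a b c d; decide
  have cd : c ≠ d := by clear * - h; revert a b c d; decide
  have h' : [d, a, b, c].Nodup := by clear * - h; revert a b c d; decide
  have ha := bary_nonneg hq a
  have hb := bary_nonneg hq b
  have hc := bary_nonneg hq c
  have hs := sum_bary_eq h' hq
  have hr1 : -(P.bary q a + P.bary q b + 2 * P.bary q c) ≤ -1 := by linarith
  have hs0 : 0 ≤ P.bary q a + P.bary q c := by linarith
  have hs1 : P.bary q a + P.bary q c ≤ 1 := by linarith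
  have ht : 1 ≤ P.bary q a + 2 * P.bary q b + 2 * P.bary q c := by linarith
  have hrst : -(P.bary q a + P.bary q b + 2 * P.bary q c) + (P.bary q a + P.bary q c) +
      (P.bary q a + 2 * P.bary q b + 2 * P.bary q c) = 1 := by linarith
  obtain ⟨x, ⟨hxa, hxb⟩, k, hk0, hk1, hxk, hx⟩ := exists_cross_first h W hp
    (hr1.trans (by norm_num)) hs0 hs1 hrst
  obtain ⟨y, ⟨hyb, hyc⟩, l, hl0, hl1, hyl, hy⟩ := exists_cross_second (P := P) h W hk0 hk1
    hs0 hs1 ht hrst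
  obtain ⟨z, ⟨hzc, hzd⟩, hz⟩ := exists_cross_third (P := P) h W hl0 hl1 hs0 hs1 hr1 hrst
  rw [← lift_roll_roll_roll_eq h W hq] at hx hy hz
  rw [← hxk] at hy
  rw [← hyl] at hz
  refine trail_cons hW hp hxa hx ?_
  rw [← lift_roll b hxa] at hy ⊢
  refine trail_cons (hW.roll ab) hxb hyb hy ?_
  rw [← lift_roll c hyb] at hz ⊢
  refine trail_cons ((hW.roll ab).roll bc) hyc hzc hz ?_
  rw [← lift_roll d hzc]
  exact trail_nil (((hW.roll ab).roll bc).roll cd) hzd hq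

end Crossing

/-! ### Trail lengths in barycentric coordinates. -/

section TrailLength

variable {p q : EuclideanSpace ℝ (Fin 3)}

theorem norm_sq_three (h : [a, b, c, d].Nodup) {W : Fin 4 → H} (hW : IsFrame a W) {r s t : ℝ}
    (hrst : r + s + t = 0) :
    ‖r • W b + s • W c + t • W d‖ ^ 2 = (r ^ 2 + s ^ 2 + t ^ 2) / 2 := by
  have h' := h
  simp only [List.nodup_cons, List.mem_cons, List.not_mem_nil, or_false, not_or] at h'
  obtain ⟨⟨ab, ac, ad⟩, ⟨bc, bd⟩, cd, -⟩ := h'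
  let f : Fin 4 → ℝ := fun i => if i = b then r else if i = c then s else if i = d then t else 0
  have fa : f a = 0 := by simp [f, ab, ac, ad]
  have fb : f b = r := by simp [f]
  have fc : f c = s := by simp [f, Ne.symm bc]
  have fd : f d = t := by simp [f, Ne.symm bd, Ne.symm cd]
  have hne : ∀ i, f i ≠ 0 → i ≠ a := by rintro i hi rfl; exact hi fa
  have key := norm_sq_sum_smul (W := W) (c := f)
    (by rw [sum_four h, fa, fb, fc, fd, zero_add, hrst])
    (fun i j hij hi hj => hW i j (hne i hi) (hne j hj) hij)
  rw [sum_four h, sum_four h, fa, fb, fc, fd] at key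
  simpa using key

theorem edist_eq_of_coords (h : [a, b, c, d].Nodup) {W : Fin 4 → H} (hW : IsFrame a W)
    (hp : p ∈ P.face a) {r s t : ℝ} (hrst : r + s + t = 1) :
    edist (P.lift W p) (r • W b + s • W c + t • W d) = ENNReal.ofReal
      √(((P.bary p b - r) ^ 2 + (P.bary p c - s) ^ 2 + (P.bary p d - t) ^ 2) / 2) := by
  have e : P.lift W p - (r • W b + s • W c + t • W d) =
      (P.bary p b - r) • W b + (P.bary p c - s) • W c + (P.bary p d - t) • W d := by
    rw [lift_eq h W hp]; module
  rw [edist_dist, dist_eq_norm, e, ← norm_sq_three h hW (by linarith [sum_bary_eq h hp]),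
    Real.sqrt_sq (norm_nonneg _)]

/-- The infimum over nets collapses once all nets containing `L` give the same value and one such
net exists. -/
theorem trailLength_eq {L : List (Fin 4)} {k l : Fin 4} {v : ENNReal}
    (hL : ∃ N : P.Net, N.HasLandscape L)
    (h : ∀ N : P.Net, N.HasLandscape L →
      segment ℝ (N.place k p) (N.place l q) ⊆ N.region L ∧ edist (N.place k p) (N.place l q) = v) :
    P.trailLength L k l p q = v := by
  refine le_antisymm ?_ (le_iInf fun N => le_iInf fun hN => le_iInf fun _ => (h N hN).2.ge)
  obtain ⟨N, hN⟩ := hL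
  exact (iInf_le_of_le N <| iInf_le_of_le hN <| iInf_le _ (h N hN).1).trans_eq (h N hN).2

theorem Net.image_place (N : P.Net) {n : Fin 4} {W : Fin 4 → EuclideanSpace ℝ (Fin 2)}
    (h : ∀ i, i ≠ n → N.place n (P.V i) = W i) : N.place n '' P.face n = P.lift W '' P.face n :=
  Set.image_congr fun _ hx => (N.place_eq_lift hx).trans (lift_congr h hx)

theorem Net.place_eq (N : P.Net) {n : Fin 4} {W : Fin 4 → EuclideanSpace ℝ (Fin 2)}
    (h : ∀ i, i ≠ n → N.place n (P.V i) = W i) (hp : p ∈ P.face n) :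
    N.place n p = P.lift W p :=
  (N.place_eq_lift hp).trans (lift_congr h hp)

theorem exists_hasLandscape_three (h : [a, b, c, d].Nodup) :
    ∃ N : P.Net, N.HasLandscape [a, b, c] := by
  obtain ⟨N, -, h2, h3⟩ := exists_strip (P := P) h
  refine ⟨N, by simp, by clear * - h; revert a b c d; decide, ?_⟩
  simp only [List.isChain_cons_cons, List.isChain_singleton, and_true] at h3 ⊢
  exact ⟨h3.1, h3.2.1⟩

theorem exists_hasLandscape_two (h : a ≠ b) : ∃ N : P.Net, N.HasLandscape [a, b] := by
  obtain ⟨c, d, h'⟩ := exists_nodup h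
  obtain ⟨N, -, h2, h3⟩ := exists_strip (P := P) h'
  refine ⟨N, by simp, by simpa using h, ?_⟩
  simp only [List.isChain_cons_cons, List.isChain_singleton, and_true] at h3 ⊢
  exact h3.1

variable (P p q) in
/-- The distance of the copies of `p ∈ F a` and `q ∈ F b` in the landscape of `F a`, `F b`. -/
def len₂ (a b c d : Fin 4) : ℝ :=
  √(((P.bary p b + P.bary q a) ^ 2 + (P.bary p c - (P.bary q c + P.bary q a)) ^ 2 +
    (P.bary p d - (P.bary q d + P.bary q a)) ^ 2) / 2)

variable (P p q) in
/-- The distance of the copies of `p ∈ F a` and `q ∈ F c` in the landscape of `F a`, `F b`,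
`F c`. -/
def len₃ (a b c d : Fin 4) : ℝ :=
  √(((P.bary p b + (P.bary q a + P.bary q b)) ^ 2 + (P.bary p c - P.bary q a) ^ 2 +
    (P.bary p d - (P.bary q a + 2 * P.bary q b + P.bary q d)) ^ 2) / 2)

variable (P p q) in
/-- The distance of the copies of `p ∈ F a` and `q ∈ F d` in the landscape of `F a`, `F b`,
`F c`, `F d`. -/
def len₄ (a b c d : Fin 4) : ℝ :=
  √(((P.bary p b + (P.bary q a + P.bary q b + 2 * P.bary q c)) ^ 2 +
    (P.bary p c - (P.bary q a + P.bary q c)) ^ 2 +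
    (P.bary p d - (P.bary q a + 2 * P.bary q b + 2 * P.bary q c)) ^ 2) / 2)

theorem edist_roll (h : [a, b, c, d].Nodup) {W : Fin 4 → H} (hW : IsFrame a W)
    (hp : p ∈ P.face a) (hq : q ∈ P.face b) :
    edist (P.lift W p) (P.lift (roll W a b) q) = ENNReal.ofReal (P.len₂ p q a b c d) := by
  have h' : [b, a, c, d].Nodup := by clear * - h; revert a b c d; decide
  rw [lift_roll_eq h W hq, edist_eq_of_coords h hW hp (by linarith [sum_bary_eq h' hq]),
    sub_neg_eq_add, len₂]

theorem edist_roll_roll (h : [a, b, c, d].Nodup) {W : Fin 4 → H} (hW : IsFrame a W)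
    (hp : p ∈ P.face a) (hq : q ∈ P.face c) :
    edist (P.lift W p) (P.lift (roll (roll W a b) b c) q) =
      ENNReal.ofReal (P.len₃ p q a b c d) := by
  have h' : [c, a, b, d].Nodup := by clear * - h; revert a b c d; decide
  rw [lift_roll_roll_eq h W hq, edist_eq_of_coords h hW hp (by linarith [sum_bary_eq h' hq]),
    sub_neg_eq_add, len₃]

theorem edist_roll_roll_roll (h : [a, b, c, d].Nodup) {W : Fin 4 → H} (hW : IsFrame a W)
    (hp : p ∈ P.face a) (hq : q ∈ P.face d) :
    edist (P.lift W p) (P.lift (roll (roll (roll W a b) b c) c d) q) =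
      ENNReal.ofReal (P.len₄ p q a b c d) := by
  have h' : [d, a, b, c].Nodup := by clear * - h; revert a b c d; decide
  rw [lift_roll_roll_roll_eq h W hq, edist_eq_of_coords h hW hp (by linarith [sum_bary_eq h' hq]),
    sub_neg_eq_add, len₄]

theorem trailLength_two (h : [a, b, c, d].Nodup) (hp : p ∈ P.face a) (hq : q ∈ P.face b) :
    P.trailLength [a, b] a b p q = ENNReal.ofReal (P.len₂ p q a b c d) := by
  refine trailLength_eq (exists_hasLandscape_two (by clear * - h; revert a b c d; decide)) ?_
  intro N hN
  obtain ⟨-, -, hc⟩ := hN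
  simp only [List.isChain_cons_cons, List.isChain_singleton, and_true] at hc
  have h0 : ∀ i, i ≠ a → N.place a (P.V i) = (N.place a ∘ P.V) i := fun _ _ => rfl
  have h1 := fun i => N.place_eq_lift_roll hc h0 (i := i)
  rw [N.place_eq h0 hp, N.place_eq h1 hq]
  refine ⟨?_, edist_roll h (N.isFrame a) hp hq⟩
  simpa [Net.region, N.image_place h0, N.image_place h1] using
    (trail_two h (N.isFrame a) hp hq).2

theorem trailLength_three (h : [a, b, c, d].Nodup) (hp : p ∈ P.face a) (hq : q ∈ P.face c) :
    P.trailLength [a, b, c] a c p q = ENNReal.ofReal (P.len₃ p q a b c d) := by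
  refine trailLength_eq (exists_hasLandscape_three h) ?_
  intro N hN
  obtain ⟨-, -, hc⟩ := hN
  simp only [List.isChain_cons_cons, List.isChain_singleton, and_true] at hc
  have h0 : ∀ i, i ≠ a → N.place a (P.V i) = (N.place a ∘ P.V) i := fun _ _ => rfl
  have h1 := fun i => N.place_eq_lift_roll hc.1 h0 (i := i)
  have h2 := fun i => N.place_eq_lift_roll hc.2 h1 (i := i)
  rw [N.place_eq h0 hp, N.place_eq h2 hq]
  refine ⟨?_, edist_roll_roll h (N.isFrame a) hp hq⟩
  simpa [Net.region, N.image_place h0, N.image_place h1, N.image_place h2] using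
    (trail_three h (N.isFrame a) hp hq).2

theorem trailLength_four (h : [a, b, c, d].Nodup) (hp : p ∈ P.face a) (hq : q ∈ P.face d) :
    P.trailLength [a, b, c, d] a d p q = ENNReal.ofReal (P.len₄ p q a b c d) := by
  refine trailLength_eq (exists_strip h) ?_
  intro N hN
  obtain ⟨-, -, hc⟩ := hN
  simp only [List.isChain_cons_cons, List.isChain_singleton, and_true] at hc
  have h0 : ∀ i, i ≠ a → N.place a (P.V i) = (N.place a ∘ P.V) i := fun _ _ => rfl
  have h1 := fun i => N.place_eq_lift_roll hc.1 h0 (i := i)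
  have h2 := fun i => N.place_eq_lift_roll hc.2.1 h1 (i := i)
  have h3 := fun i => N.place_eq_lift_roll hc.2.2 h2 (i := i)
  rw [N.place_eq h0 hp, N.place_eq h3 hq]
  refine ⟨?_, edist_roll_roll_roll h (N.isFrame a) hp hq⟩
  simpa [Net.region, N.image_place h0, N.image_place h1, N.image_place h2, N.image_place h3] using
    (trail_four h (N.isFrame a) hp hq).2

theorem isFrame_vertices (P : UnitTetrahedron) (n : Fin 4) : IsFrame n P.V :=
  fun i j _ _ hij => P.dist_eq_one i j hij

/-- No net is involved: the strip is unrolled in space, into the plane of the first face, with the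
true vertices as frame. -/
theorem surfaceDist_le_len₂ (h : [a, b, c, d].Nodup) (hp : p ∈ P.face a) (hq : q ∈ P.face b) :
    P.surfaceDist p q ≤ ENNReal.ofReal (P.len₂ p q a b c d) :=
  (trail_two h (P.isFrame_vertices a) hp hq).1.trans_eq (edist_roll h (P.isFrame_vertices a) hp hq)

theorem surfaceDist_le_len₃ (h : [a, b, c, d].Nodup) (hp : p ∈ P.face a) (hq : q ∈ P.face c) :
    P.surfaceDist p q ≤ ENNReal.ofReal (P.len₃ p q a b c d) :=
  (trail_three h (P.isFrame_vertices a) hp hq).1.trans_eq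
    (edist_roll_roll h (P.isFrame_vertices a) hp hq)

theorem surfaceDist_le_len₄ (h : [a, b, c, d].Nodup) (hp : p ∈ P.face a) (hq : q ∈ P.face d) :
    P.surfaceDist p q ≤ ENNReal.ofReal (P.len₄ p q a b c d) :=
  (trail_four h (P.isFrame_vertices a) hp hq).1.trans_eq
    (edist_roll_roll_roll h (P.isFrame_vertices a) hp hq)

end TrailLength

end UnitTetrahedron

end

noncomputable section

open Finset

namespace UnitTetrahedron

/-! ### Nearest copies in the triangular lattice. -/

section Arithmetic

theorem sq_le_sq_sub_two_mul {u : ℝ} (h : |u| ≤ 1) (k : ℤ) : u ^ 2 ≤ (u - 2 * k) ^ 2 := by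
  rw [abs_le] at h
  suffices 0 ≤ (k : ℝ) * (k - u) by linarith
  rcases lt_trichotomy k 0 with hk | rfl | hk
  · have : (k : ℝ) ≤ -1 := by exact_mod_cast Int.le_sub_one_of_lt hk
    exact mul_nonneg_of_nonpos_of_nonpos (by linarith) (by linarith)
  · simp
  · have : (1 : ℝ) ≤ k := by exact_mod_cast hk
    exact mul_nonneg (by linarith) (by linarith)

theorem sq_le_sq_sub_two_mul_or {u : ℝ} (h0 : 0 ≤ u) (h2 : u ≤ 2) (k : ℤ) :
    u ^ 2 ≤ (u - 2 * k) ^ 2 ∨ (u - 2) ^ 2 ≤ (u - 2 * k) ^ 2 := by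
  rcases le_or_gt k 0 with hk | hk
  · have : (k : ℝ) ≤ 0 := by exact_mod_cast hk
    exact Or.inl (by nlinarith)
  · have : (1 : ℝ) ≤ k := by exact_mod_cast hk
    exact Or.inr (by nlinarith)

variable {x₁ x₂ A B : ℝ} (hA : 0 ≤ A) (hB : 0 ≤ B) (h₁ : A / 2 ≤ x₁) (h₁' : x₁ ≤ 1 - A / 2)
  (h₂ : B / 2 ≤ x₂) (h₂' : x₂ ≤ 1 - B / 2)

include hA hB h₁ h₁' h₂ h₂'

/-- Copies that are translates of the direct neighbour. For even `j` both coordinates of that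
neighbour are already minimal modulo two. For odd `j` the horizontal one has two candidates, which
give the two trails through all four faces. -/
theorem le_of_translation (i j : ℤ) {N : ℝ}
    (hN : N = (x₁ + x₂ - 1 - (2 * i + j)) ^ 2 + 3 / 4 * (A + B - 2 * j) ^ 2) :
    (x₁ + x₂ - 1) ^ 2 + 3 / 4 * (A + B) ^ 2 ≤ N ∨
    (x₁ + x₂) ^ 2 + 3 / 4 * (A + B - 2) ^ 2 ≤ N ∨
    (x₁ + x₂ - 2) ^ 2 + 3 / 4 * (A + B - 2) ^ 2 ≤ N := by
  rcases Int.even_or_odd' j with ⟨m, rfl | rfl⟩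
  · have e1 := sq_le_sq_sub_two_mul (u := x₁ + x₂ - 1) (abs_le.2 ⟨by linarith, by linarith⟩) (i + m)
    have e2 := sq_le_sq_sub_two_mul (u := (A + B) / 2) (abs_le.2 ⟨by linarith, by linarith⟩) m
    left
    push_cast at *
    rw [hN]
    linarith
  · have e1 := sq_le_sq_sub_two_mul_or (u := x₁ + x₂) (by linarith) (by linarith) (i + m + 1)
    have e2 := sq_le_sq_sub_two_mul (u := (A + B - 2) / 2)
      (abs_le.2 ⟨by linarith, by linarith⟩) m
    right
    push_cast at *
    rw [hN]
    rcases e1 with e1 | e1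
    · left; linarith
    · right; linarith

/-- Half-turned copies. Even `j` leads to the two trails through three faces; the copies with odd
`j` are never closer than the direct neighbour. -/
theorem le_of_rotation (i j : ℤ) {N : ℝ}
    (hN : N = (x₁ - x₂ + 1 - (2 * i + j)) ^ 2 + 3 / 4 * (A - B - 2 * j) ^ 2) :
    (x₁ + x₂ - 1) ^ 2 + 3 / 4 * (A + B) ^ 2 ≤ N ∨
    (x₁ - x₂ + 1) ^ 2 + 3 / 4 * (A - B) ^ 2 ≤ N ∨
    (x₁ - x₂ - 1) ^ 2 + 3 / 4 * (A - B) ^ 2 ≤ N := by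
  rcases Int.even_or_odd' j with ⟨m, rfl | rfl⟩
  · have e1 := sq_le_sq_sub_two_mul_or (u := x₁ - x₂ + 1) (by linarith) (by linarith) (i + m)
    have e2 := sq_le_sq_sub_two_mul (u := (A - B) / 2) (abs_le.2 ⟨by linarith, by linarith⟩) m
    right
    push_cast at *
    rw [hN]
    rcases e1 with e1 | e1
    · left; linarith
    · right; linarith
  · have e1 := sq_le_sq_sub_two_mul (u := x₁ - x₂) (abs_le.2 ⟨by linarith, by linarith⟩) (i + m)
    have e2 := sq_le_sq_sub_two_mul_or (u := (A - B + 2) / 2) (by linarith) (by linarith) (m + 1)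
    left
    -- The direct trail gains at most this product in the horizontal square, by `|2x - 1| ≤ 1 - A`
    -- in a triangle. In the vertical square it saves at least `3 (1 - B) (1 + A)` or `3 (1 - A) (1
    -- + B)`, which is enough.
    have e3 : (2 * x₁ - 1) * (2 * x₂ - 1) ≤ (1 - A) * (1 - B) := by
      refine (le_abs_self _).trans ?_
      rw [abs_mul]
      exact mul_le_mul (abs_le.2 ⟨by linarith, by linarith⟩) (abs_le.2 ⟨by linarith, by linarith⟩)
        (abs_nonneg _) (by linarith)
    have e4 : 0 ≤ (1 - A) * B := mul_nonneg (by linarith) hB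
    have e5 : 0 ≤ (1 - B) * A := mul_nonneg (by linarith) hA
    push_cast at *
    rw [hN]
    rcases e2 with e2 | e2 <;> nlinarith

omit hA hB h₁ h₁' h₂ h₂'

theorem abs_le_one_of_unit {m n : ℤ} (h : m ^ 2 + m * n + n ^ 2 = 1) :
    (-1 ≤ m ∧ m ≤ 1) ∧ -1 ≤ n ∧ n ≤ 1 := by
  have hm : m ^ 2 ≤ 1 := by nlinarith [sq_nonneg (2 * n + m)]
  have hn : n ^ 2 ≤ 1 := by nlinarith [sq_nonneg (2 * m + n)]
  exact ⟨abs_le.1 ((sq_le_one_iff_abs_le_one m).1 hm), abs_le.1 ((sq_le_one_iff_abs_le_one n).1 hn)⟩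

/-- The shape of a unit triangle of the triangular lattice with vertices in given classes
modulo two. -/
theorem eq_of_unit_triangle {m n m' n' : ℤ} (hm : Odd m) (hn : Even n) (hm' : Odd m') (hn' : Odd n')
    (h1 : m ^ 2 + m * n + n ^ 2 = 1) (h2 : m' ^ 2 + m' * n' + n' ^ 2 = 1)
    (h3 : (m' - m) ^ 2 + (m' - m) * (n' - n) + (n' - n) ^ 2 = 1) :
    n = 0 ∧ m' = m ∧ n' = -m ∧ (m = 1 ∨ m = -1) := by
  obtain ⟨⟨a1, a2⟩, a3, a4⟩ := abs_le_one_of_unit h1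
  obtain ⟨⟨b1, b2⟩, b3, b4⟩ := abs_le_one_of_unit h2
  obtain ⟨m, rfl⟩ := hm
  obtain ⟨n, rfl⟩ := hn
  obtain ⟨m', rfl⟩ := hm'
  obtain ⟨n', rfl⟩ := hn'
  obtain rfl : n = 0 := by omega
  have c1 : m = 0 ∨ m = -1 := by omega
  have c2 : m' = 0 ∨ m' = -1 := by omega
  have c3 : n' = 0 ∨ n' = -1 := by omega
  rcases c1 with rfl | rfl <;> rcases c2 with rfl | rfl <;> rcases c3 with rfl | rfl <;> simp_all

end Arithmetic

variable {P : UnitTetrahedron} {a b c d : Fin 4}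

/-! ### The five lengths in planar coordinates. -/

section Coordinates

variable {p q : EuclideanSpace ℝ (Fin 3)}

/-- The abscissa of `p` uses the weight at `V c` and that of `q` the weight at `V d`, because the
two faces run through their common edge in opposite directions. The factor `3/4` is the squared
height of a face. -/
theorem len₂_eq (h : [a, b, c, d].Nodup) (hp : p ∈ P.face a) (hq : q ∈ P.face b) :
    P.len₂ p q a b c d =
      √((P.bary p c + P.bary p b / 2 + (P.bary q d + P.bary q a / 2) - 1) ^ 2 +
        3 / 4 * (P.bary p b + P.bary q a) ^ 2) := by
  have e1 : P.bary p d = 1 - P.bary p b - P.bary p c := by linarith [sum_bary_eq h hp]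
  have e2 : P.bary q d = 1 - P.bary q a - P.bary q c := by
    linarith [sum_bary_eq (P := P) (a := b) (b := a) (c := c) (d := d)
      (by clear * - h; revert a b c d; decide) hq]
  rw [len₂, e1, e2]
  congr 1
  ring

theorem len₃_eq (h : [a, b, c, d].Nodup) (hp : p ∈ P.face a) (hq : q ∈ P.face b) :
    P.len₃ p q a c b d =
      √((P.bary p c + P.bary p b / 2 - (P.bary q d + P.bary q a / 2) + 1) ^ 2 +
        3 / 4 * (P.bary p b - P.bary q a) ^ 2) := by
  have e1 : P.bary p d = 1 - P.bary p b - P.bary p c := by linarith [sum_bary_eq h hp]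
  have e2 : P.bary q d = 1 - P.bary q a - P.bary q c := by
    linarith [sum_bary_eq (P := P) (a := b) (b := a) (c := c) (d := d)
      (by clear * - h; revert a b c d; decide) hq]
  rw [len₃, e1, e2]
  congr 1
  ring

theorem len₃_eq' (h : [a, b, c, d].Nodup) (hp : p ∈ P.face a) (hq : q ∈ P.face b) :
    P.len₃ p q a d b c =
      √((P.bary p c + P.bary p b / 2 - (P.bary q d + P.bary q a / 2) - 1) ^ 2 +
        3 / 4 * (P.bary p b - P.bary q a) ^ 2) := by
  have e1 : P.bary p d = 1 - P.bary p b - P.bary p c := by linarith [sum_bary_eq h hp]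
  have e2 : P.bary q d = 1 - P.bary q a - P.bary q c := by
    linarith [sum_bary_eq (P := P) (a := b) (b := a) (c := c) (d := d)
      (by clear * - h; revert a b c d; decide) hq]
  rw [len₃, e1, e2]
  congr 1
  ring

theorem len₄_eq (h : [a, b, c, d].Nodup) (hp : p ∈ P.face a) (hq : q ∈ P.face b) :
    P.len₄ p q a c d b =
      √((P.bary p c + P.bary p b / 2 + (P.bary q d + P.bary q a / 2)) ^ 2 +
        3 / 4 * (P.bary p b + P.bary q a - 2) ^ 2) := by
  have e1 : P.bary p d = 1 - P.bary p b - P.bary p c := by linarith [sum_bary_eq h hp]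
  have e2 : P.bary q d = 1 - P.bary q a - P.bary q c := by
    linarith [sum_bary_eq (P := P) (a := b) (b := a) (c := c) (d := d)
      (by clear * - h; revert a b c d; decide) hq]
  rw [len₄, e1, e2]
  congr 1
  ring

theorem len₄_eq' (h : [a, b, c, d].Nodup) (hp : p ∈ P.face a) (hq : q ∈ P.face b) :
    P.len₄ p q a d c b =
      √((P.bary p c + P.bary p b / 2 + (P.bary q d + P.bary q a / 2) - 2) ^ 2 +
        3 / 4 * (P.bary p b + P.bary q a - 2) ^ 2) := by
  have e1 : P.bary p d = 1 - P.bary p b - P.bary p c := by linarith [sum_bary_eq h hp]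
  have e2 : P.bary q d = 1 - P.bary q a - P.bary q c := by
    linarith [sum_bary_eq (P := P) (a := b) (b := a) (c := c) (d := d)
      (by clear * - h; revert a b c d; decide) hq]
  rw [len₄, e1, e2]
  congr 1
  ring

end Coordinates

/-! ### Unrolling the surface onto a lattice. -/

section Unrolling

variable {H : Type*} [NormedAddCommGroup H] [InnerProductSpace ℝ H] {L : Type*} [AddCommGroup L]

/-- `z` is a copy of the point `x` obtained by rolling the tetrahedron over the plane: a face
containing `x` lies on a unit triangle of the lattice `f L` whose vertices belong to the classes
`cls` modulo two. -/
def IsUnrolling (P : UnitTetrahedron) (f : L →+ H) (cls : Fin 4 → L)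
    (x : EuclideanSpace ℝ (Fin 3)) (z : H) (n : Fin 4) : Prop :=
  x ∈ P.face n ∧ ∃ Z : Fin 4 → L, (∀ i, i ≠ n → ∃ u, Z i = cls i + (u + u)) ∧
    IsFrame n (fun i => f (Z i)) ∧ z = P.lift (fun i => f (Z i)) x

/-- Rolling onto the other face keeps the copy of `x`. The new vertex `Z i + Z j - Z m` has the
right class because the four classes add up to zero modulo two. -/
theorem IsUnrolling.change_face {f : L →+ H} {cls : Fin 4 → L} (hcls : ∃ s, ∑ i, cls i = s + s)
    {x : EuclideanSpace ℝ (Fin 3)} {z : H} {n m : Fin 4} (h : P.IsUnrolling f cls x z n)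
    (hx : x ∈ P.face m) : P.IsUnrolling f cls x z m := by
  by_cases hnm : n = m
  · exact hnm ▸ h
  obtain ⟨hxn, Z, hZ, hW, rfl⟩ := h
  have hroll : (fun i => f (roll Z n m i)) = roll (fun i => f (Z i)) n m :=
    funext fun i => map_roll f Z n m i
  refine ⟨hx, roll Z n m, fun k hk => ?_, ?_, ?_⟩
  · by_cases hkn : k = n
    · subst hkn
      obtain ⟨i, j, hd⟩ := exists_nodup hnm
      obtain ⟨s, hs⟩ := hcls
      rw [sum_four hd] at hs
      rw [roll_apply_self Z hd]
      simp only [List.nodup_cons, List.mem_cons, List.not_mem_nil, or_false, not_or] at hd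
      obtain ⟨u, hu⟩ := hZ i (by tauto)
      obtain ⟨v, hv⟩ := hZ j (by tauto)
      obtain ⟨w, hw⟩ := hZ m (by tauto)
      refine ⟨s - cls k - cls m + u + v - w, ?_⟩
      rw [hu, hv, hw]
      have : cls j = s + s - cls k - cls m - cls i := by rw [← hs]; abel
      rw [this]; abel
    · rw [roll_apply_of_ne _ hkn]; exact hZ k hkn
  · rw [hroll]; exact hW.roll hnm
  · rw [hroll, lift_roll m hxn]

/-- A path on the surface unrolls to a path in the plane that is no longer. -/
theorem exists_unrolling_of_path {f : L →+ H} {cls : Fin 4 → L} (hcls : ∃ s, ∑ i, cls i = s + s)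
    {p q : EuclideanSpace ℝ (Fin 3)} {z : H} {n m : Fin 4} (h : P.IsUnrolling f cls p z n)
    (hq : q ∈ P.face m) (γ : Path p q) (hγ : ∀ t, γ t ∈ P.surface) :
    ∃ z', P.IsUnrolling f cls q z' m ∧ edist z z' ≤ eVariationOn γ Set.univ := by
  -- The lifting relation forgets the face, so a copy can be continued into any face containing the
  -- point.
  obtain ⟨z', ⟨k, hz'⟩, hd⟩ := exists_lift_along (F := P.face) (isClosed_face (P := P))
    (R := fun x z => ∃ n, P.IsUnrolling f cls x z n) (fun i x hx y hy z hz => by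
      obtain ⟨n, hz⟩ := hz
      obtain ⟨-, Z, hZ, hW, rfl⟩ := hz.change_face hcls hx
      refine ⟨_, ⟨i, hy, Z, hZ, hW, rfl⟩, ?_⟩
      rw [edist_dist, edist_dist, dist_lift hW hx hy]) γ.continuous univ 0 z
    (fun τ _ => by simpa [surface] using hγ τ) ⟨n, by rwa [γ.source]⟩
  rw [γ.target] at hz'
  exact ⟨z', hz'.change_face hcls hq, hd.trans (eVariationOn.mono _ (Set.subset_univ _))⟩

end Unrolling

end UnitTetrahedron

end

noncomputable section

open Finset

namespace UnitTetrahedron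

variable {P : UnitTetrahedron} {a b c d : Fin 4} {p q : EuclideanSpace ℝ (Fin 3)}

/-! ### Every path is at least as long as one of the five trails. -/

section LowerBound

variable (P) in
/-- The embedding of the triangular lattice in the plane of the face spanned by `V b`, `V c`,
`V d`, with `V d` as origin. -/
def latticeEmbedding (b c d : Fin 4) : ℤ × ℤ →+ EuclideanSpace ℝ (Fin 3) where
  toFun z := (z.1 : ℝ) • (P.V c - P.V d) + (z.2 : ℝ) • (P.V b - P.V d)
  map_zero' := by simp
  map_add' x y := by
    simp only [Prod.fst_add, Prod.snd_add, Int.cast_add]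
    module

theorem norm_sq_lattice (h : [a, b, c, d].Nodup) (s r : ℝ) :
    ‖s • (P.V c - P.V d) + r • (P.V b - P.V d)‖ ^ 2 = s ^ 2 + s * r + r ^ 2 := by
  have e : s • (P.V c - P.V d) + r • (P.V b - P.V d) =
      r • P.V b + s • P.V c + (-(r + s)) • P.V d := by module
  rw [e, norm_sq_three h (P.isFrame_vertices a) (by ring)]
  ring

theorem unit_of_dist_eq_one (h : [a, b, c, d].Nodup) {z w : ℤ × ℤ}
    (hzw : dist (P.latticeEmbedding b c d z) (P.latticeEmbedding b c d w) = 1) :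
    (z.1 - w.1) ^ 2 + (z.1 - w.1) * (z.2 - w.2) + (z.2 - w.2) ^ 2 = 1 := by
  have key := norm_sq_lattice (P := P) h ((z - w).1 : ℝ) ((z - w).2 : ℝ)
  have e : ((z - w).1 : ℝ) • (P.V c - P.V d) + ((z - w).2 : ℝ) • (P.V b - P.V d) =
      P.latticeEmbedding b c d (z - w) := rfl
  rw [e, map_sub, ← dist_eq_norm, hzw] at key
  have key' : ((z - w).1 : ℝ) ^ 2 + (z - w).1 * (z - w).2 + (z - w).2 ^ 2 = 1 := by linarith
  simp only [Prod.fst_sub, Prod.snd_sub] at key'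
  exact_mod_cast key'

/-- Every path on the surface between two faces is at least as long as one of five trails. -/
theorem exists_len_le_eVariationOn (h : [a, b, c, d].Nodup) (hp : p ∈ P.face a) (hq : q ∈ P.face b)
    (γ : Path p q) (hγ : ∀ t, γ t ∈ P.surface) :
    ENNReal.ofReal (P.len₂ p q a b c d) ≤ eVariationOn γ Set.univ ∨
    ENNReal.ofReal (P.len₃ p q a c b d) ≤ eVariationOn γ Set.univ ∨
    ENNReal.ofReal (P.len₃ p q a d b c) ≤ eVariationOn γ Set.univ ∨
    ENNReal.ofReal (P.len₄ p q a c d b) ≤ eVariationOn γ Set.univ ∨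
    ENNReal.ofReal (P.len₄ p q a d c b) ≤ eVariationOn γ Set.univ := by
  have h' : [b, a, c, d].Nodup := by clear * - h; revert a b c d; decide
  have hn := h
  simp only [List.nodup_cons, List.mem_cons, List.not_mem_nil, or_false, not_or] at hn
  obtain ⟨⟨ab, ac, ad⟩, ⟨bc, bd⟩, cd, -⟩ := hn
  let f := P.latticeEmbedding b c d
  -- The vertices take the four residue classes modulo two. Their sum is `(2, 2)`, as `change_face`
  -- requires.
  let cls : Fin 4 → ℤ × ℤ := fun i =>
    if i = a then (1, 1) else if i = b then (0, 1) else if i = c then (1, 0) else (0, 0)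
  have ca : cls a = (1, 1) := by simp [cls]
  have cb : cls b = (0, 1) := by simp [cls, Ne.symm ab]
  have cc : cls c = (1, 0) := by simp [cls, Ne.symm ac, Ne.symm bc]
  have cd' : cls d = (0, 0) := by simp [cls, Ne.symm ad, Ne.symm bd, Ne.symm cd]
  have hcls : ∃ s, ∑ i, cls i = s + s := ⟨(1, 1), by rw [sum_four h, ca, cb, cc, cd']; rfl⟩
  have fb : f (cls b) = P.V b - P.V d := by rw [cb]; simp [f, latticeEmbedding]
  have fc : f (cls c) = P.V c - P.V d := by rw [cc]; simp [f, latticeEmbedding]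
  have fd : f (cls d) = P.V d - P.V d := by rw [cd']; simp [f, latticeEmbedding]
  have fV : ∀ i, i ≠ a → f (cls i) = P.V i - P.V d := by
    intro i hi
    rcases eq_of_nodup h i with rfl | rfl | rfl | rfl
    exacts [absurd rfl hi, fb, fc, fd]
  have start : P.IsUnrolling f cls p (P.lift (fun i => f (cls i)) p) a := by
    refine ⟨hp, cls, fun i _ => ⟨0, by simp⟩, fun i j hi hj hij => ?_, rfl⟩
    simp only [fV i hi, fV j hj]
    rw [dist_sub_right, P.dist_eq_one i j hij]
  obtain ⟨z', ⟨-, Z, hZ, hW, rfl⟩, hd⟩ := exists_unrolling_of_path hcls start hq γ hγ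
  obtain ⟨u, hu⟩ := hZ a ab
  obtain ⟨v, hv⟩ := hZ c (Ne.symm bc)
  obtain ⟨⟨i, j⟩, hw⟩ := hZ d (Ne.symm bd)
  have g1 := unit_of_dist_eq_one h (hW c d (Ne.symm bc) (Ne.symm bd) cd)
  have g2 := unit_of_dist_eq_one h (hW a d ab (Ne.symm bd) ad)
  have g3 := unit_of_dist_eq_one h (hW a c ab (Ne.symm bc) ac)
  rw [ca] at hu
  rw [cc] at hv
  rw [cd'] at hw
  -- Parity leaves two shapes for the copy of the second face: a translate of the direct neighbour,
  -- or its half-turn. The sign `ε` below distinguishes them.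
  obtain ⟨t1, t2, t3, t4⟩ := eq_of_unit_triangle
    (m := (Z c).1 - (Z d).1) (n := (Z c).2 - (Z d).2) (m' := (Z a).1 - (Z d).1)
    (n' := (Z a).2 - (Z d).2) ⟨v.1 - i, by rw [hv, hw]; simp; ring⟩
    ⟨v.2 - j, by rw [hv, hw]; simp; ring⟩ ⟨u.1 - i, by rw [hu, hw]; simp; ring⟩
    ⟨u.2 - j, by rw [hu, hw]; simp; ring⟩ g1 g2
    (by rw [sub_sub_sub_cancel_right, sub_sub_sub_cancel_right]; exact g3)
  obtain ⟨ε, hε⟩ : ∃ ε, ε = (Z c).1 - (Z d).1 := ⟨_, rfl⟩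
  rw [← hε] at t2 t3 t4
  have Zd : Z d = (2 * i, 2 * j) := by rw [hw]; ext <;> simp <;> ring
  rw [Zd] at t1 t2 t3 hε
  simp only at t1 t2 t3 hε
  have Zc : Z c = (2 * i + ε, 2 * j) := by ext <;> simp <;> linarith
  have Za : Z a = (2 * i + ε, 2 * j - ε) := by ext <;> simp <;> linarith
  have hα := sum_bary_eq h hp
  have hβ := sum_bary_eq h' hq
  have αb := bary_nonneg hp b
  have αc := bary_nonneg hp c
  have αd := bary_nonneg hp d
  have βa := bary_nonneg hq a
  have βc := bary_nonneg hq c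
  have βd := bary_nonneg hq d
  have diff : P.lift (fun i => f (cls i)) p - P.lift (fun i => f (Z i)) q =
      (P.bary p c - (2 * i + ε * (P.bary q a + P.bary q c))) • (P.V c - P.V d) +
        (P.bary p b - (2 * j - ε * P.bary q a)) • (P.V b - P.V d) := by
    have e1 : P.bary q d = 1 - P.bary q a - P.bary q c := by linarith
    rw [lift_eq h _ hp, lift_eq h' _ hq, fb, fc, fd, Za, Zc, Zd, e1]
    simp only [f, latticeEmbedding, AddMonoidHom.coe_mk, ZeroHom.coe_mk]
    push_cast
    module
  have hdist : edist (P.lift (fun i => f (cls i)) p) (P.lift (fun i => f (Z i)) q) =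
      ENNReal.ofReal √((P.bary p c + P.bary p b / 2 - ε * (P.bary q c + P.bary q a / 2) -
        (2 * i + j)) ^ 2 + 3 / 4 * (P.bary p b + ε * P.bary q a - 2 * j) ^ 2) := by
    rw [edist_dist, dist_eq_norm, diff, ← Real.sqrt_sq (norm_nonneg _), norm_sq_lattice h]
    congr 2
    ring
  rw [hdist] at hd
  rw [len₂_eq h hp hq, len₃_eq h hp hq, len₃_eq' h hp hq, len₄_eq h hp hq, len₄_eq' h hp hq]
  have fin : ∀ {M N : ℝ}, M ≤ N → ENNReal.ofReal √N ≤ eVariationOn γ Set.univ →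
      ENNReal.ofReal √M ≤ eVariationOn γ Set.univ :=
    fun hMN hN => (ENNReal.ofReal_le_ofReal (Real.sqrt_le_sqrt hMN)).trans hN
  rcases t4 with rfl | rfl
  · rcases le_of_translation (x₁ := P.bary p c + P.bary p b / 2)
      (x₂ := P.bary q d + P.bary q a / 2) αb βa (by linarith) (by linarith) (by linarith)
      (by linarith) i j rfl with h1 | h1 | h1
    all_goals
      rw [show P.bary p c + P.bary p b / 2 + (P.bary q d + P.bary q a / 2) - 1 - (2 * i + j) =
        P.bary p c + P.bary p b / 2 - ((1 : ℤ) : ℝ) * (P.bary q c + P.bary q a / 2) - (2 * i + j) by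
          push_cast; linarith,
        show P.bary p b + P.bary q a = P.bary p b + ((1 : ℤ) : ℝ) * P.bary q a by
          push_cast; ring] at h1
    · exact Or.inl (fin (by convert h1 using 1; push_cast; ring) hd)
    · exact Or.inr (Or.inr (Or.inr (Or.inl (fin (by convert h1 using 1; push_cast; ring) hd))))
    · exact Or.inr (Or.inr (Or.inr (Or.inr (fin (by convert h1 using 1; push_cast; ring) hd))))
  · rcases le_of_rotation (x₁ := P.bary p c + P.bary p b / 2)
      (x₂ := P.bary q d + P.bary q a / 2) αb βa (by linarith) (by linarith) (by linarith)
      (by linarith) i j rfl with h1 | h1 | h1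
    all_goals
      rw [show P.bary p c + P.bary p b / 2 - (P.bary q d + P.bary q a / 2) + 1 - (2 * i + j) =
        P.bary p c + P.bary p b / 2 - ((-1 : ℤ) : ℝ) * (P.bary q c + P.bary q a / 2) -
          (2 * i + j) by push_cast; linarith,
        show P.bary p b - P.bary q a - 2 * j = P.bary p b + ((-1 : ℤ) : ℝ) * P.bary q a - 2 * j by
          push_cast; ring] at h1
    · exact Or.inl (fin h1 hd)
    · exact Or.inr (Or.inl (fin h1 hd))
    · exact Or.inr (Or.inr (Or.inl (fin h1 hd)))

end LowerBound

/-- The isometry is affine on the face, and unit distances together with the upper half-plane force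
the third vertex to `(1/2, √3/2)`. -/
theorem HasRep.coords {n m u v : Fin 4} {x y : ℝ} (h : P.HasRep p n m x y) (hc : P.CCW n u v m) :
    x = P.bary p v + P.bary p m / 2 ∧ y = √3 / 2 * P.bary p m := by
  obtain ⟨hp, u', v', hc', g, hg, hpos, hu, hv, hgp⟩ := h
  obtain ⟨rfl, rfl⟩ := hc.eq_of_ccw hc'
  have hnod := hc.1
  have e := eq_lift_of_isometric hg hp
  rw [lift_eq hnod _ hp, hgp] at e
  simp only [Function.comp, hu, hv] at e
  simp only [List.nodup_cons, List.mem_cons, List.not_mem_nil, or_false, not_or] at hnod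
  obtain ⟨⟨nu, nv, nm⟩, ⟨uv, um⟩, vm, -⟩ := hnod
  have hm := vertex_mem_face (P := P) (Ne.symm nm)
  have d1 := hg _ hm _ (vertex_mem_face (Ne.symm nu))
  have d2 := hg _ hm _ (vertex_mem_face (Ne.symm nv))
  rw [P.dist_eq_one _ _ (Ne.symm um), hu] at d1
  rw [P.dist_eq_one _ _ (Ne.symm vm), hv] at d2
  have s1 := dist_sq_plane (g (P.V m)) !₂[0, 0]
  have s2 := dist_sq_plane (g (P.V m)) !₂[1, 0]
  rw [d1] at s1
  rw [d2] at s2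
  have hy := hpos _ hm
  simp at s1 s2
  have w0 : g (P.V m) 0 = 1 / 2 := by linarith
  have w1 : g (P.V m) 1 = √3 / 2 := by
    have h3 : √3 ^ 2 = (3 : ℝ) := Real.sq_sqrt (by norm_num)
    rw [w0] at s1
    rw [← sq_eq_sq₀ hy (by positivity), div_pow, h3]
    linarith
  have e0 := congrArg (fun z => z 0) e
  have e1 := congrArg (fun z => z 1) e
  simp [w0] at e0
  simp [w1] at e1
  exact ⟨by linarith, by linarith⟩

/-! ### Enumeration and validity of the landscapes. -/

section Landscapes

/-- A list without repetition in `Fin 4` has at most four entries, so fixed ends leave five lists.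
Strips realise them all. -/
theorem setOf_isLandscapeFromTo (h : [a, b, c, d].Nodup) :
    {L | P.IsLandscapeFromTo a b L} =
      {[a, b], [a, c, b], [a, d, b], [a, c, d, b], [a, d, c, b]} := by
  ext L
  simp only [Set.mem_ofPred_eq, Set.mem_insert_iff, Set.mem_singleton_iff]
  constructor
  · rintro ⟨⟨N, h2, hnod, -⟩, hh, hl⟩
    have h4 := hnod.length_le_card
    rw [Fintype.card_fin] at h4
    match L, h2, h4 with
    | [x, y], _, _ =>
      simp at hh hl
      subst hh hl
      simp
    | [x, y, z], _, _ =>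
      simp at hh hl
      subst hh hl
      clear * - h hnod
      revert x y z c d; decide
    | [x, y, z, w], _, _ =>
      simp at hh hl
      subst hh hl
      clear * - h hnod
      revert x y z w c d; decide
  · have h1 : [a, c, b, d].Nodup := by clear * - h; revert a b c d; decide
    have h2 : [a, d, b, c].Nodup := by clear * - h; revert a b c d; decide
    have h3 : [a, c, d, b].Nodup := by clear * - h; revert a b c d; decide
    have h4 : [a, d, c, b].Nodup := by clear * - h; revert a b c d; decide
    rintro (rfl | rfl | rfl | rfl | rfl)
    · exact ⟨exists_hasLandscape_two (by clear * - h; revert a b c d; decide), rfl, rfl⟩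
    · exact ⟨exists_hasLandscape_three h1, rfl, rfl⟩
    · exact ⟨exists_hasLandscape_three h2, rfl, rfl⟩
    · exact ⟨exists_strip h3, rfl, rfl⟩
    · exact ⟨exists_strip h4, rfl, rfl⟩

theorem _root_.List.IsInfix.eq_of_mem_ends {α : Type*} {L M : List α} {a b : α} (hM : M <:+: L)
    (hL : L.Nodup) (ha : L.head? = some a) (hb : L.getLast? = some b) (haM : a ∈ M) (hbM : b ∈ M) :
    M = L := by
  obtain ⟨s, t, rfl⟩ := hM
  rw [List.nodup_append, List.nodup_append] at hL
  obtain ⟨⟨-, -, h1⟩, -, h2⟩ := hL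
  have hs : s = [] := by
    rcases s with _ | ⟨x, s⟩
    · rfl
    · simp at ha
      exact absurd ha (h1 x (by simp) a haM)
  have ht : t = [] := by
    rcases List.eq_nil_or_concat t with rfl | ⟨t, x, rfl⟩
    · rfl
    · simp at hb
      exact absurd hb.symm (h2 b (by simp [hbM]) x (by simp))
  simp [hs, ht]

/-- As `p` and `q` lie in one face each, a landscape containing them contains both ends of `L`. A
subpath with both ends is all of `L`, up to reversal, so only the equality of lengths remains. -/
theorem IsLandscapeFromTo.isValid {L : List (Fin 4)} (hL : P.IsLandscapeFromTo a b L)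
    (hp : p ∈ P.face a) (hp' : ∀ k, p ∈ P.face k → k = a) (hq : q ∈ P.face b)
    (hq' : ∀ k, q ∈ P.face k → k = b) (hT : P.trailLength L a b p q = P.surfaceDist p q) :
    P.IsValid L := by
  obtain ⟨hL, ha, hb⟩ := hL
  obtain ⟨N, -, hnod, -⟩ := id hL
  refine ⟨hL, a, List.mem_of_mem_head? ha, b, List.mem_of_mem_getLast? hb, p, hp, q, hq, hT, ?_⟩
  intro M _ hML hMR k hk l hl hpk hql _ hsub
  obtain rfl := hp' k hpk
  obtain rfl := hq' l hql
  rcases hsub with hs | hs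
  · exact hML (hs.eq_of_mem_ends hnod ha hb hk hl)
  · refine hMR ?_
    rw [← hs.eq_of_mem_ends hnod ha hb (by simpa using hk) (by simpa using hl), List.reverse_reverse]

theorem exists_interior_point (h : [a, b, c, d].Nodup) {r s t : ℝ} (hr : 0 < r) (hs : 0 < s)
    (ht : 0 < t) (hrst : r + s + t = 1) :
    ∃ p ∈ P.face a, (∀ k, p ∈ P.face k → k = a) ∧ P.bary p b = r ∧ P.bary p c = s ∧
      P.bary p d = t := by
  have hn := h
  simp only [List.nodup_cons, List.mem_cons, List.not_mem_nil, or_false, not_or] at hn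
  obtain ⟨⟨ab, ac, ad⟩, ⟨bc, bd⟩, cd, -⟩ := hn
  let α : Fin 4 → ℝ := fun i => if i = b then r else if i = c then s else if i = d then t else 0
  have αa : α a = 0 := by simp [α, ab, ac, ad]
  have αb : α b = r := by simp [α]
  have αc : α c = s := by simp [α, Ne.symm bc]
  have αd : α d = t := by simp [α, Ne.symm bd, Ne.symm cd]
  have h1 : ∑ i, α i = 1 := by rw [sum_four h, αa, αb, αc, αd, zero_add, hrst]
  have hbary := P.bary_sum_smul h1
  refine ⟨∑ i, α i • P.V i, sum_smul_mem_face (fun i => ?_) αa h1, fun k hk => ?_, ?_, ?_, ?_⟩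
  · simp only [α]; split_ifs <;> linarith
  · have := bary_self hk
    rw [hbary] at this
    rcases eq_of_nodup h k with rfl | rfl | rfl | rfl
    · rfl
    · linarith
    · linarith
    · linarith
  all_goals rw [hbary]; assumption

theorem le_surfaceDist (h : [a, b, c, d].Nodup) (hp : p ∈ P.face a) (hq : q ∈ P.face b) {v : ℝ}
    (h1 : v ≤ P.len₂ p q a b c d) (h2 : v ≤ P.len₃ p q a c b d) (h3 : v ≤ P.len₃ p q a d b c)
    (h4 : v ≤ P.len₄ p q a c d b) (h5 : v ≤ P.len₄ p q a d c b) :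
    ENNReal.ofReal v ≤ P.surfaceDist p q := by
  refine le_iInf₂ fun γ hγ => ?_
  rcases exists_len_le_eVariationOn h hp hq γ hγ with h | h | h | h | h
  · exact (ENNReal.ofReal_le_ofReal h1).trans h
  · exact (ENNReal.ofReal_le_ofReal h2).trans h
  · exact (ENNReal.ofReal_le_ofReal h3).trans h
  · exact (ENNReal.ofReal_le_ofReal h4).trans h
  · exact (ENNReal.ofReal_le_ofReal h5).trans h

theorem isValid_two (h : [a, b, c, d].Nodup) : P.IsValid [a, b] := by
  have h' : [b, a, c, d].Nodup := by revert a b c d; decide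
  -- Both points are close to the middle of the common edge.
  obtain ⟨p, hp, hp', p1, p2, p3⟩ := exists_interior_point (P := P) h (r := 1 / 5) (s := 2 / 5)
    (t := 2 / 5) (by norm_num) (by norm_num) (by norm_num) (by norm_num)
  obtain ⟨q, hq, hq', q1, q2, q3⟩ := exists_interior_point (P := P) h' (r := 1 / 5) (s := 2 / 5)
    (t := 2 / 5) (by norm_num) (by norm_num) (by norm_num) (by norm_num)
  have hL : [a, b] ∈ {L | P.IsLandscapeFromTo a b L} := by
    rw [setOf_isLandscapeFromTo h]; simp
  refine IsLandscapeFromTo.isValid hL hp hp' hq hq' ?_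
  rw [trailLength_two h hp hq]
  refine le_antisymm (le_surfaceDist h hp hq le_rfl ?_ ?_ ?_ ?_) (surfaceDist_le_len₂ h hp hq)
  all_goals
    simp only [len₂_eq h hp hq, len₃_eq h hp hq, len₃_eq' h hp hq, len₄_eq h hp hq,
      len₄_eq' h hp hq, p1, p2, q1, q3]
    exact Real.sqrt_le_sqrt (by norm_num)

theorem isValid_three (h : [a, b, c, d].Nodup) : P.IsValid [a, c, b] := by
  have h' : [b, a, c, d].Nodup := by revert a b c d; decide
  have h'' : [a, c, b, d].Nodup := by clear * - h; revert a b c d; decide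
  -- Small weights at `V c` put both points near the face `F c`. The squared length is `0.36`,
  -- against `0.48` for the direct trail.
  obtain ⟨p, hp, hp', p1, p2, p3⟩ := exists_interior_point (P := P) h (r := 2 / 5) (s := 1 / 10)
    (t := 1 / 2) (by norm_num) (by norm_num) (by norm_num) (by norm_num)
  obtain ⟨q, hq, hq', q1, q2, q3⟩ := exists_interior_point (P := P) h' (r := 2 / 5) (s := 1 / 10)
    (t := 1 / 2) (by norm_num) (by norm_num) (by norm_num) (by norm_num)
  have hL : [a, c, b] ∈ {L | P.IsLandscapeFromTo a b L} := by
    rw [setOf_isLandscapeFromTo h]; simp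
  refine IsLandscapeFromTo.isValid hL hp hp' hq hq' ?_
  rw [trailLength_three h'' hp hq]
  refine le_antisymm (le_surfaceDist h hp hq ?_ le_rfl ?_ ?_ ?_) (surfaceDist_le_len₃ h'' hp hq)
  all_goals
    simp only [len₂_eq h hp hq, len₃_eq h hp hq, len₃_eq' h hp hq, len₄_eq h hp hq,
      len₄_eq' h hp hq, p1, p2, q1, q3]
    exact Real.sqrt_le_sqrt (by norm_num)

theorem isValid_four (h : [a, b, c, d].Nodup) : P.IsValid [a, c, d, b] := by
  have h' : [b, a, c, d].Nodup := by revert a b c d; decide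
  have h'' : [a, c, d, b].Nodup := by clear * - h; revert a b c d; decide
  -- The points lie near the vertices off the common edge, `p` leaning towards `F c` and `q` towards
  -- `F d`. The squared length is `0.91`, against `1` for both trails through three faces.
  obtain ⟨p, hp, hp', p1, p2, p3⟩ := exists_interior_point (P := P) h (r := 7 / 10) (s := 1 / 20)
    (t := 1 / 4) (by norm_num) (by norm_num) (by norm_num) (by norm_num)
  obtain ⟨q, hq, hq', q1, q2, q3⟩ := exists_interior_point (P := P) h' (r := 7 / 10) (s := 1 / 4)
    (t := 1 / 20) (by norm_num) (by norm_num) (by norm_num) (by norm_num)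
  have hL : [a, c, d, b] ∈ {L | P.IsLandscapeFromTo a b L} := by
    rw [setOf_isLandscapeFromTo h]; simp
  refine IsLandscapeFromTo.isValid hL hp hp' hq hq' ?_
  rw [trailLength_four h'' hp hq]
  refine le_antisymm (le_surfaceDist h hp hq ?_ ?_ ?_ le_rfl ?_) (surfaceDist_le_len₄ h'' hp hq)
  all_goals
    simp only [len₂_eq h hp hq, len₃_eq h hp hq, len₃_eq' h hp hq, len₄_eq h hp hq,
      len₄_eq' h hp hq, p1, p2, q1, q3]
    exact Real.sqrt_le_sqrt (by norm_num)

end Landscapes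

end UnitTetrahedron

end

/-! ### The main theorem. -/

open UnitTetrahedron in
theorem mainTheorem1 (P : UnitTetrahedron) (n₁ n₂ : Fin 4) (hn : n₁ ≠ n₂) :
    -- there are exactly five landscapes from the first face to the second, and all are valid
    {L | P.IsLandscapeFromTo n₁ n₂ L}.encard = 5 ∧
    (∀ L, P.IsLandscapeFromTo n₁ n₂ L → P.IsValid L) ∧
    -- the two remaining faces, named according to the direction of rotation
    ∃ n₃ n₄ : Fin 4, P.CCW n₁ n₄ n₃ n₂ ∧
      ∃ L : Fin 5 → List (Fin 4),
        L = ![[n₁, n₂], [n₁, n₃, n₂], [n₁, n₄, n₂], [n₁, n₃, n₄, n₂], [n₁, n₄, n₃, n₂]] ∧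
        Function.Injective L ∧
        Set.range L = {L | P.IsLandscapeFromTo n₁ n₂ L} ∧
        ∀ p₁ ∈ P.face n₁ \ P.face n₂, ∀ p₂ ∈ P.face n₂ \ P.face n₁, ∀ x₁ y₁ x₂ y₂ : ℝ,
          P.HasRep p₁ n₁ n₂ x₁ y₁ → P.HasRep p₂ n₂ n₁ x₂ y₂ →
            -- the surface distance is the least trail length in the five landscapes
            P.surfaceDist p₁ p₂ = ⨅ i, P.trailLength (L i) n₁ n₂ p₁ p₂ ∧
            -- and the five trail lengths are as follows
            ∀ i, P.trailLength (L i) n₁ n₂ p₁ p₂ = ENNReal.ofReal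
              ((![√((x₁ + x₂ - 1) ^ 2 + (y₁ + y₂) ^ 2),
                  √((x₁ - x₂ + 1) ^ 2 + (y₁ - y₂) ^ 2),
                  √((x₁ - x₂ - 1) ^ 2 + (y₁ - y₂) ^ 2),
                  √((x₁ + x₂) ^ 2 + (y₁ + y₂ - √3) ^ 2),
                  √((x₁ + x₂ - 2) ^ 2 + (y₁ + y₂ - √3) ^ 2)] : Fin 5 → ℝ) i) := by
  obtain ⟨n₃, n₄, hc⟩ : ∃ n₃ n₄, P.CCW n₁ n₄ n₃ n₂ := by
    obtain ⟨c, d, h⟩ := exists_nodup hn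
    rcases P.ccw_or_ccw h with h1 | h1
    · exact ⟨d, c, h1.rotate⟩
    · exact ⟨c, d, h1.rotate⟩
  have hd := hc.1
  have h : [n₁, n₂, n₃, n₄].Nodup := by clear * - hd; revert n₁ n₂ n₃ n₄; decide
  have h' : [n₁, n₂, n₄, n₃].Nodup := by clear * - hd; revert n₁ n₂ n₃ n₄; decide
  have h2 : [n₁, n₃, n₂, n₄].Nodup := by clear * - hd; revert n₁ n₂ n₃ n₄; decide
  have h3 : [n₁, n₄, n₂, n₃].Nodup := by clear * - hd; revert n₁ n₂ n₃ n₄; decide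
  have h4 : [n₁, n₃, n₄, n₂].Nodup := by clear * - hd; revert n₁ n₂ n₃ n₄; decide
  have h5 : [n₁, n₄, n₃, n₂].Nodup := by clear * - hd; revert n₁ n₂ n₃ n₄; decide
  have hset := setOf_isLandscapeFromTo (P := P) h
  have hinj : Function.Injective
      ![[n₁, n₂], [n₁, n₃, n₂], [n₁, n₄, n₂], [n₁, n₃, n₄, n₂], [n₁, n₄, n₃, n₂]] := by
    clear * - hd; revert n₁ n₂ n₃ n₄; decide
  have hrange : Set.range
      ![[n₁, n₂], [n₁, n₃, n₂], [n₁, n₄, n₂], [n₁, n₃, n₄, n₂], [n₁, n₄, n₃, n₂]] =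
      {L | P.IsLandscapeFromTo n₁ n₂ L} := by
    rw [hset]
    simp only [Matrix.range_cons, Matrix.range_empty, Set.union_empty, Set.singleton_union]
  refine ⟨?_, ?_, n₃, n₄, hc, _, rfl, hinj, hrange, ?_⟩
  · rw [← hrange, ← Set.image_univ, hinj.encard_image]; simp
  · intro L hL
    have : L ∈ {L | P.IsLandscapeFromTo n₁ n₂ L} := hL
    rw [hset] at this
    rcases this with rfl | rfl | rfl | rfl | rfl
    · exact isValid_two h
    · exact isValid_three h
    · exact isValid_three h'
    · exact isValid_four h
    · exact isValid_four h'
  · rintro p ⟨hp, -⟩ q ⟨hq, -⟩ x₁ y₁ x₂ y₂ hr₁ hr₂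
    have t1 := trailLength_two h hp hq
    have t2 := trailLength_three h2 hp hq
    have t3 := trailLength_three h3 hp hq
    have t4 := trailLength_four h4 hp hq
    have t5 := trailLength_four h5 hp hq
    constructor
    · refine le_antisymm (le_iInf fun i => ?_) (le_iInf₂ fun γ hγ => ?_)
      · fin_cases i
        · exact (surfaceDist_le_len₂ h hp hq).trans_eq t1.symm
        · exact (surfaceDist_le_len₃ h2 hp hq).trans_eq t2.symm
        · exact (surfaceDist_le_len₃ h3 hp hq).trans_eq t3.symm
        · exact (surfaceDist_le_len₄ h4 hp hq).trans_eq t4.symm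
        · exact (surfaceDist_le_len₄ h5 hp hq).trans_eq t5.symm
      · rcases exists_len_le_eVariationOn h hp hq γ hγ with hl | hl | hl | hl | hl
        · exact (iInf_le _ 0).trans (t1.trans_le hl)
        · exact (iInf_le _ 1).trans (t2.trans_le hl)
        · exact (iInf_le _ 2).trans (t3.trans_le hl)
        · exact (iInf_le _ 3).trans (t4.trans_le hl)
        · exact (iInf_le _ 4).trans (t5.trans_le hl)
    · obtain ⟨rfl, rfl⟩ := hr₁.coords hc
      -- The second face runs through the common edge from `V n₃` to `V n₄`, so its abscissa starts
      -- at the other end.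
      obtain ⟨rfl, rfl⟩ := hr₂.coords hc.swap
      rw [len₂_eq h hp hq] at t1
      rw [len₃_eq h hp hq] at t2
      rw [len₃_eq' h hp hq] at t3
      rw [len₄_eq h hp hq] at t4
      rw [len₄_eq' h hp hq] at t5
      have h3 : √3 ^ 2 = (3 : ℝ) := Real.sq_sqrt (by norm_num)
      have sq : ∀ r : ℝ, (√3 / 2 * r) ^ 2 = 3 / 4 * r ^ 2 := fun r => by
        rw [mul_pow, div_pow, h3]; ring
      have e1 : ∀ r s : ℝ, √3 / 2 * r + √3 / 2 * s = √3 / 2 * (r + s) := fun r s => by ring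
      have e2 : ∀ r s : ℝ, √3 / 2 * r - √3 / 2 * s = √3 / 2 * (r - s) := fun r s => by ring
      have e3 : ∀ r : ℝ, √3 / 2 * r - √3 = √3 / 2 * (r - 2) := fun r => by ring
      simp only [e1, e2, e3, sq]
      intro i
      fin_cases i
      · exact t1
      · exact t2
      · exact t3
      · exact t4
      · exact t5
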